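/- Let $L\ge 0$, let $k_1,\dots,k_L$ and $n_1,\dots,n_{L+1}$ be non-negative integers, and let $V$ be the complex vector space of all tuples of complex matrices $x=(Z_i,\Upsilon_i,\widetilde\Upsilon_i\ (1\le i\le L);\ W_i\ (1\le i\le L-1))$, where $Z_i$ is $k_i\times k_i$, $\Upsilon_i$ is $n_i\times k_i$, $\widetilde\Upsilon_i$ is $k_i\times n_{i+1}$ and $W_i$ is $k_i\times k_{i+1}$. Let $$F_i(x)=\widetilde\Upsilon_i\Upsilon_{i+1}-Z_iW_i+W_iZ_{i+1}\qquad(1\le i\le L-1),$$ and let $F=(F_i)_i$. Call $x$ \emph{free} if for every $1\le i\le L$ the only vector $v\in\mathbb C^{k_i}$ such that $$\Upsilon_jW_jW_{j+1}\cdots W_{i-1}(z\mathbf 1_{k_i}-Z_i)^{-1}v=0\quad\text{for all }1\le j\le i\text{ and all }z\in\mathbb C\text{ with } z\mathbf 1_{k_i}-Z_i\text{ invertible}$$ is $v=0$. Let $\mathcal M_0=\{x\in V: F(x)=0,\ x\text{ free}\}$, with the subspace topology, and let the vortex moduli space be $\mathcal M=\mathcal M_0/\prod_{i=1}^L GL(k_i,\mathbb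 C)$, with the quotient topology, where $(U_i)$ acts by $$(Z_i,\Upsilon_i,\widetilde\Upsilon_i,W_i)\mapsto(U_i^{-1}Z_iU_i,\ \Upsilon_iU_i,\ U_i^{-1}\widetilde\Upsilon_i,\ U_i^{-1}W_iU_{i+1}).$$ Then: 1. At every free point $x\in V$ (in particular at every point of $\mathcal M_0$), the differentials of all the scalar components of $F$ are linearly independent; equivalently, the Jacobian of $F$ has the maximal rank $\sum_{i=1}^{L-1}k_ik_{i+1}$. 2. The moduli space $\mathcal M$ is a smooth complex manifold of the expected dimension $\sum_{i=1}^Lk_i(n_i+n_{i+1})$. More precisely, put $d=\sum_{i=1}^L k_i(n_i+n_{i+1})$. The set $\mathcal M_0$ is an embedded complex submanifold of $V$ of dimension $d+\sum_{i=1}^Lk_i^2$, the space $\mathcal M$ is Hausdorff and second countable, and $\mathcal M$ carries the structure of a complex manifold of dimension $d$, compatible with its topology, for which the projection $\mathcal M_0\to\mathcal M$ is a holomorphic submersion. (The empty set counts as a manifold of every dimension.) -/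

import Mathlib

open scoped Manifold ContDiff

noncomputable section

namespace VortexQuiver

/-- The complex vector space of all matrix data `(Z, Υ, Υ̃, W)` for the quiver with `L` gauge nodes,
vortex numbers `k 0, …, k (L-1)` and flavour numbers `n 0, …, n L` (indices start from `0`):
* `Z i` is `k i × k i`, `Υ i` is `n i × k i`, `Υ̃ i` is `k i × n (i+1)`, for `i < L`;
* `W i` is `k i × k (i+1)`, for `i < L - 1`.
Matrices are stored as plain functions, so that the product normed space structure is available;
values of `k` and `n` beyond the ranges above are never used. -/
abbrev Data (L : ℕ) (k n : ℕ → ℕ) : Type :=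
  ((i : Fin L) → Fin (k i) → Fin (k i) → ℂ) ×
  ((i : Fin L) → Fin (n i) → Fin (k i) → ℂ) ×
  ((i : Fin L) → Fin (k i) → Fin (n (i + 1)) → ℂ) ×
  ((i : Fin (L - 1)) → Fin (k i) → Fin (k (i + 1)) → ℂ)

variable {L : ℕ} {k n : ℕ → ℕ}

/-- The matrix `Z_i`. -/
def Data.Z (x : Data L k n) (i : ℕ) (hi : i < L) : Matrix (Fin (k i)) (Fin (k i)) ℂ :=
  Matrix.of (x.1 ⟨i, hi⟩)

/-- The matrix `Υ_i`. -/
def Data.Ups (x : Data L k n) (i : ℕ) (hi : i < L) : Matrix (Fin (n i)) (Fin (k i)) ℂ :=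
  Matrix.of (x.2.1 ⟨i, hi⟩)

/-- The matrix `Υ̃_i`. -/
def Data.UpsT (x : Data L k n) (i : ℕ) (hi : i < L) :
    Matrix (Fin (k i)) (Fin (n (i + 1))) ℂ :=
  Matrix.of (x.2.2.1 ⟨i, hi⟩)

/-- The matrix `W_i`. -/
def Data.W (x : Data L k n) (i : ℕ) (hi : i + 1 < L) :
    Matrix (Fin (k i)) (Fin (k (i + 1))) ℂ :=
  Matrix.of (x.2.2.2 ⟨i, by omega⟩)

/-- The left-hand side `Υ̃_i Υ_{i+1} - Z_i W_i + W_i Z_{i+1}` of the `i`-th constraint. -/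
def constraintMatrix (x : Data L k n) (i : ℕ) (hi : i + 1 < L) :
    Matrix (Fin (k i)) (Fin (k (i + 1))) ℂ :=
  x.UpsT i (by omega) * x.Ups (i + 1) hi - x.Z i (by omega) * x.W i hi
    + x.W i hi * x.Z (i + 1) hi

/-- The constraint map `F`, with all components of all the constraints. -/
def constraintMap (x : Data L k n) :
    (i : Fin (L - 1)) → Fin (k i) → Fin (k (i + 1)) → ℂ :=
  fun i a b => constraintMatrix x i (by omega) a b

/-- The matrix `Υ_j W_j W_{j+1} ⋯ W_{i-1}` for `j ≤ i < L`; it is `Υ_i` for `j = i`. -/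
def chain (x : Data L k n) (j i : ℕ) (hji : j ≤ i) :
    i < L → Matrix (Fin (n j)) (Fin (k i)) ℂ :=
  Nat.leRec (motive := fun i _ => i < L → Matrix (Fin (n j)) (Fin (k i)) ℂ)
    (fun h => x.Ups j h) (fun i _ P h => P (by omega) * x.W i h) hji

theorem chain_self (x : Data L k n) (j : ℕ) (h : j < L) :
    chain x j j le_rfl h = x.Ups j h := by
  simp [chain, Nat.leRec_self]

theorem chain_succ (x : Data L k n) (j i : ℕ) (hji : j ≤ i) (h : i + 1 < L) :
    chain x j (i + 1) (by omega) h = chain x j i hji (by omega) * x.W i h := by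
  simp [chain, Nat.leRec_succ _ _ hji]

/-- The free condition: for every node `i`, a vector `v` with
`Υ_j W_j ⋯ W_{i-1} (z - Z_i)⁻¹ v = 0` for all `j ≤ i` and all `z` that are not eigenvalues
of `Z_i` is zero. -/
def IsFree (x : Data L k n) : Prop :=
  ∀ (i : ℕ) (hi : i < L) (v : Fin (k i) → ℂ),
    (∀ (j : ℕ) (hj : j ≤ i) (z : ℂ),
      IsUnit (z • (1 : Matrix (Fin (k i)) (Fin (k i)) ℂ) - x.Z i hi) →
      Matrix.mulVec (chain x j i hj hi *
        (z • (1 : Matrix (Fin (k i)) (Fin (k i)) ℂ) - x.Z i hi)⁻¹) v = 0) →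
    v = 0

/-- The set `𝓜₀` of the free data that solve all the constraints. -/
def solutionSet (L : ℕ) (k n : ℕ → ℕ) : Set (Data L k n) :=
  {x | constraintMap x = 0 ∧ IsFree x}

/-- `y` arises from `x` by the transformation with parameters `U_i ∈ GL(k_i, ℂ)`:
`Z_i ↦ U_i⁻¹ Z_i U_i`, `Υ_i ↦ Υ_i U_i`, `Υ̃_i ↦ U_i⁻¹ Υ̃_i`, `W_i ↦ U_i⁻¹ W_i U_{i+1}`. -/
def IsTransform (U : (i : ℕ) → i < L → GL (Fin (k i)) ℂ) (x y : Data L k n) : Prop :=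
  (∀ i hi, y.Z i hi = (U i hi)⁻¹.val * x.Z i hi * (U i hi).val) ∧
  (∀ i hi, y.Ups i hi = x.Ups i hi * (U i hi).val) ∧
  (∀ i hi, y.UpsT i hi = (U i hi)⁻¹.val * x.UpsT i hi) ∧
  (∀ i hi, y.W i hi = (U i (by omega))⁻¹.val * x.W i hi * (U (i + 1) hi).val)

theorem IsTransform.refl (x : Data L k n) : IsTransform (fun _ _ => 1) x x := by
  refine ⟨fun i hi => ?_, fun i hi => ?_, fun i hi => ?_, fun i hi => ?_⟩ <;>
    simp only [inv_one, Units.val_one, Matrix.one_mul, Matrix.mul_one]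

theorem IsTransform.symm {U : (i : ℕ) → i < L → GL (Fin (k i)) ℂ} {x y : Data L k n}
    (h : IsTransform U x y) : IsTransform (fun i hi => (U i hi)⁻¹) y x := by
  have e1 : ∀ i hi, (U i hi).val * (U i hi)⁻¹.val = 1 := fun i hi => Units.mul_inv _
  have e2 : ∀ (i : ℕ) (hi : i < L) (m : ℕ) (A : Matrix (Fin (k i)) (Fin m) ℂ),
      (U i hi).val * ((U i hi)⁻¹.val * A) = A := fun i hi m A => by
    rw [← Matrix.mul_assoc, e1, Matrix.one_mul]
  obtain ⟨h1, h2, h3, h4⟩ := h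
  refine ⟨fun i hi => ?_, fun i hi => ?_, fun i hi => ?_, fun i hi => ?_⟩ <;>
    simp only [h1, h2, h3, h4, inv_inv, Matrix.mul_assoc, e1, e2, Matrix.mul_one]

theorem IsTransform.trans {U V : (i : ℕ) → i < L → GL (Fin (k i)) ℂ} {x y w : Data L k n}
    (h : IsTransform U x y) (h' : IsTransform V y w) :
    IsTransform (fun i hi => U i hi * V i hi) x w := by
  obtain ⟨h1, h2, h3, h4⟩ := h
  obtain ⟨g1, g2, g3, g4⟩ := h'
  refine ⟨fun i hi => ?_, fun i hi => ?_, fun i hi => ?_, fun i hi => ?_⟩ <;>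
    simp only [h1, h2, h3, h4, g1, g2, g3, g4, mul_inv_rev, Units.val_mul, Matrix.mul_assoc]

/-- Two solutions are equivalent if they are related by an element of `∏ GL(k_i, ℂ)`. -/
instance moduliSetoid (L : ℕ) (k n : ℕ → ℕ) : Setoid (solutionSet L k n) where
  r x y := ∃ U : (i : ℕ) → i < L → GL (Fin (k i)) ℂ, IsTransform U x.1 y.1
  iseqv :=
    { refl := fun x => ⟨_, IsTransform.refl x.1⟩
      symm := fun ⟨_, h⟩ => ⟨_, h.symm⟩
      trans := fun ⟨_, h⟩ ⟨_, h'⟩ => ⟨_, h.trans h'⟩ }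

/-- The vortex moduli space, with the quotient topology. -/
abbrev ModuliSpace (L : ℕ) (k n : ℕ → ℕ) : Type := Quotient (moduliSetoid L k n)

/-- The quotient map from the solution set to the moduli space. -/
def proj (L : ℕ) (k n : ℕ → ℕ) : solutionSet L k n → ModuliSpace L k n := Quotient.mk _

/-- The expected complex dimension `∑ k_i (n_i + n_{i+1})` of the moduli space. -/
def moduliDim (L : ℕ) (k n : ℕ → ℕ) : ℕ := ∑ i ∈ Finset.range L, k i * (n i + n (i + 1))

/-- The complex dimension `∑ k_i ^ 2` of `∏ GL(k_i, ℂ)`. -/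
def gaugeDim (L : ℕ) (k : ℕ → ℕ) : ℕ := ∑ i ∈ Finset.range L, k i ^ 2

/-- The number `∑ k_i k_{i+1}` of the scalar constraints. -/
def numConstraints (L : ℕ) (k : ℕ → ℕ) : ℕ := ∑ i ∈ Finset.range (L - 1), k i * k (i + 1)

end VortexQuiver

end

/-! A linear relation among the differentials of the components of `F` at `x` is a family of
matrices `A_i` with `∑ tr(A_i dF_i) = 0`. Varying `Υ̃`, `W` and `Z` separately gives `Υ_{i+1} A_i =
0`, `Z_{i+1} A_i = A_i Z_i`, `W_0 A_0 = 0` and `A_i W_i = W_{i+1} A_{i+1}`. Hence `Υ_j W_j ⋯ W_i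
Z_{i+1}^p A_i = 0` for all `j` and `p`, and freeness forces `A_i = 0` (`cokernel_eq_zero`,
`relation_eq_zero`).

Freeness says that the map `O_i(x)`, which collects all `Υ_j W_j ⋯ W_{i-1} Z_i^p` with `p < k_i`, is
injective (`isFree_iff_obsMap`), and `O_i(x·U) = O_i(x) U_i`. If `P_i` is a left inverse of
`O_i(x₀)`, then `s = P ∘ O` is a matrix-valued function with `s(x·U) = s(x) U` and `s(x₀) = 1`.
Where `s` is invertible, each orbit meets `s = 1` in the single point `x·s(x)⁻¹` (`normalize`). The
pair `(s, F)` is a submersion at `x₀`: `dF` is onto, and `ds` is bijective on orbit directions,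
which `dF` kills. Completing it by a linear function of `normalize` gives coordinates of `V` in
which `𝓜₀` is a linear slice and the orbits are the fibres of a projection (`exists_adaptedChart`).
Such charts yield both manifold structures, the embedding and the submersion
(`exists_manifold_structures`).

The quotient is Hausdorff because the orbit relation is closed: the intertwiner between nearby
normalized points can be read off continuously as `s`, and a limiting intertwiner is invertible
because its target is free (`isClosed_orbitRel`). -/

section

open Set Filter Topology

/-! ### Adapted charts and the inverse function theorem -/

/-- A chart of `V` adapted to a subset `S` and a map `π : S → Q`: it straightens `S` to the slice on
which the last coordinate vanishes, and the fibres of `π` to the fibres of the first coordinate. -/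
structure AdaptedChart {V Q : Type*} (A B C : Type*)
    [NormedAddCommGroup V] [NormedSpace ℂ V] [NormedAddCommGroup A] [NormedSpace ℂ A]
    [NormedAddCommGroup B] [NormedSpace ℂ B] [NormedAddCommGroup C] [NormedSpace ℂ C]
    (S : Set V) (π : S → Q) where
  /-- The underlying local homeomorphism. -/
  Φ : OpenPartialHomeomorph V ((A × B) × C)
  contDiffOn : ContDiffOn ℂ ω Φ Φ.source
  contDiffOn_symm : ContDiffOn ℂ ω Φ.symm Φ.target
  mem_iff : ∀ y ∈ Φ.source, y ∈ S ↔ (Φ y).2 = 0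
  fiber_iff : ∀ y y' : S, y.1 ∈ Φ.source → y'.1 ∈ Φ.source →
    (π y = π y' ↔ (Φ y.1).1.1 = (Φ y'.1).1.1)

/-- If `f` is a submersion at `x₀` and the derivative of `ρ` is the identity on the kernel of the
derivative of `f`, then `f` can be completed to a local coordinate system by a linear function
of `ρ`. -/
theorem exists_straightening {V A B C : Type*}
    [NormedAddCommGroup V] [NormedSpace ℂ V] [NormedAddCommGroup A] [NormedSpace ℂ A]
    [NormedAddCommGroup B] [NormedSpace ℂ B] [NormedAddCommGroup C] [NormedSpace ℂ C]
    [FiniteDimensional ℂ V] [FiniteDimensional ℂ A] [FiniteDimensional ℂ B]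
    [FiniteDimensional ℂ C] {x₀ : V} {f : V → B × C} {ρ : V → V}
    (hf : ContDiffAt ℂ ω f x₀) (hρ : ContDiffAt ℂ ω ρ x₀)
    (hsurj : Function.Surjective (fderiv ℂ f x₀))
    (hker : ∀ ξ, fderiv ℂ f x₀ ξ = 0 → fderiv ℂ ρ x₀ ξ = ξ)
    (hdim : Module.finrank ℂ V = Module.finrank ℂ A + Module.finrank ℂ (B × C)) :
    ∃ (h : V →L[ℂ] A) (Φ : OpenPartialHomeomorph V ((A × B) × C)), x₀ ∈ Φ.source ∧
      ContDiffOn ℂ ω Φ Φ.source ∧ ContDiffOn ℂ ω Φ.symm Φ.target ∧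
      ∀ x, Φ x = ((h (ρ x), (f x).1), (f x).2) := by
  have : CompleteSpace V := FiniteDimensional.complete ℂ V
  have hω : (ω : WithTop ℕ∞) ≠ 0 := by simp
  set D : V →ₗ[ℂ] B × C := (fderiv ℂ f x₀ : V →ₗ[ℂ] B × C) with hD
  have hK : Module.finrank ℂ (LinearMap.ker D) = Module.finrank ℂ A := by
    have h1 := D.finrank_range_add_finrank_ker
    rw [LinearMap.range_eq_top.2 hsurj, finrank_top] at h1
    omega
  let iso : LinearMap.ker D ≃ₗ[ℂ] A := LinearEquiv.ofFinrankEq _ _ hK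
  -- By dimension `ker df` is isomorphic to `A`; extending such an isomorphism to `V` makes `h ∘ dρ`
  -- injective on `ker df`, where `dρ` is the identity.
  obtain ⟨h₀, hh₀⟩ := LinearMap.exists_extend iso.toLinearMap
  let h : V →L[ℂ] A := LinearMap.toContinuousLinearMap h₀
  have hh : ∀ ξ, ∀ hξ : D ξ = 0, h ξ = iso ⟨ξ, hξ⟩ := fun ξ hξ =>
    congrArg (fun l : LinearMap.ker D →ₗ[ℂ] A => l ⟨ξ, hξ⟩) hh₀
  let F : V → (A × B) × C := fun x => ((h (ρ x), (f x).1), (f x).2)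
  have hF : ContDiffAt ℂ ω F x₀ :=
    ((h.contDiff.contDiffAt.comp x₀ hρ).prodMk hf.fst).prodMk hf.snd
  have hfd := (hf.differentiableAt hω).hasFDerivAt
  have hρd := (hρ.differentiableAt hω).hasFDerivAt
  have hFd : HasFDerivAt F (((h.comp (fderiv ℂ ρ x₀)).prod
      ((ContinuousLinearMap.fst ℂ B C).comp (fderiv ℂ f x₀))).prod
      ((ContinuousLinearMap.snd ℂ B C).comp (fderiv ℂ f x₀))) x₀ :=
    ((h.hasFDerivAt.comp x₀ hρd).prodMk hfd.fst).prodMk hfd.snd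
  set T := (((h.comp (fderiv ℂ ρ x₀)).prod
      ((ContinuousLinearMap.fst ℂ B C).comp (fderiv ℂ f x₀))).prod
      ((ContinuousLinearMap.snd ℂ B C).comp (fderiv ℂ f x₀))) with hT
  have hinj : Function.Injective T := by
    rw [injective_iff_map_eq_zero]
    intro ξ hξ
    simp only [hT, ContinuousLinearMap.prod_apply, ContinuousLinearMap.comp_apply,
      Prod.mk_eq_zero, ContinuousLinearMap.coe_fst', ContinuousLinearMap.coe_snd'] at hξ
    have h0 : D ξ = 0 := Prod.ext hξ.1.2 hξ.2
    have h1 := hξ.1.1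
    rw [hker ξ h0, hh ξ h0, LinearEquiv.map_eq_zero_iff] at h1
    exact congrArg Subtype.val h1
  have hdim' : Module.finrank ℂ V = Module.finrank ℂ ((A × B) × C) := by
    rw [hdim]; simp only [Module.finrank_prod]; omega
  let T' : V ≃L[ℂ] (A × B) × C :=
    (LinearEquiv.ofInjectiveOfFinrankEq T.toLinearMap hinj hdim').toContinuousLinearEquiv
  have hFd' : HasFDerivAt F (T' : V →L[ℂ] (A × B) × C) x₀ := by
    convert hFd using 1
    ext1 ξ
    rfl
  let Φ := hF.toOpenPartialHomeomorph F hFd' hω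
  have hx₀ : x₀ ∈ Φ.source := hF.mem_toOpenPartialHomeomorph_source hFd' hω
  -- The source is shrunk so that the map and its inverse are analytic throughout, not only at the
  -- base point.
  refine ⟨h, Φ.restrContDiff ℂ ω (by decide), ?_, Φ.contDiffOn_restrContDiff_source ℂ _,
    Φ.contDiffOn_restrContDiff_target ℂ _, fun x => rfl⟩
  rw [OpenPartialHomeomorph.restrContDiff_source]
  exact ⟨hx₀, hF, hF.to_localInverse hFd' hω⟩

/-! ### Charts induced on the subset and on the quotient -/

namespace AdaptedChart

variable {V Q A B C E : Type*}
  [NormedAddCommGroup V] [NormedSpace ℂ V] [NormedAddCommGroup A] [NormedSpace ℂ A]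
  [NormedAddCommGroup B] [NormedSpace ℂ B] [NormedAddCommGroup C] [NormedSpace ℂ C]
  [NormedAddCommGroup E] [NormedSpace ℂ E]
  {S : Set V} {π : S → Q}

theorem symm_mem (c : AdaptedChart A B C S π) {p : A × B} (hp : (p, (0 : C)) ∈ c.Φ.target) :
    c.Φ.symm (p, 0) ∈ S := by
  rw [c.mem_iff _ (c.Φ.map_target hp), c.Φ.right_inv hp]

theorem apply_eq (c : AdaptedChart A B C S π) (y : S) (hy : y.1 ∈ c.Φ.source) :
    c.Φ y.1 = ((c.Φ y.1).1, 0) :=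
  Prod.ext rfl ((c.mem_iff _ hy).1 y.2)

open Classical in
/-- The chart of the subset induced by an adapted chart. -/
noncomputable def subsetChart (c : AdaptedChart A B C S π) (x₀ : S) (e : (A × B) ≃L[ℂ] E) :
    OpenPartialHomeomorph S E where
  toFun y := e (c.Φ y.1).1
  -- The point `x₀` is a dummy value outside the target.
  invFun m := if h : (e.symm m, (0 : C)) ∈ c.Φ.target then ⟨_, c.symm_mem h⟩ else x₀
  source := {y | y.1 ∈ c.Φ.source}
  target := {m | (e.symm m, (0 : C)) ∈ c.Φ.target}
  map_source' y hy := by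
    have := c.Φ.map_source hy
    rw [c.apply_eq y hy] at this
    simpa using this
  map_target' m hm := by
    have hm' : (e.symm m, (0 : C)) ∈ c.Φ.target := hm
    simp [hm', c.Φ.map_target hm']
  left_inv' y hy := by
    have := c.Φ.map_source hy
    have h2 := c.apply_eq y hy
    rw [h2] at this
    apply Subtype.ext
    simp only [e.symm_apply_apply, this, dif_pos]
    rw [← h2, c.Φ.left_inv hy]
  right_inv' m hm := by
    have hm' : (e.symm m, (0 : C)) ∈ c.Φ.target := hm
    simp [hm', c.Φ.right_inv hm']
  open_source := c.Φ.open_source.preimage continuous_subtype_val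
  open_target := c.Φ.open_target.preimage (by fun_prop)
  continuousOn_toFun := by
    have h : ContinuousOn (fun y : S => c.Φ y.1) {y | y.1 ∈ c.Φ.source} :=
      c.Φ.continuousOn.comp continuous_subtype_val.continuousOn fun y hy => hy
    exact e.continuous.comp_continuousOn h.fst
  continuousOn_invFun := by
    rw [Topology.IsInducing.subtypeVal.continuousOn_iff]
    have h : ContinuousOn (fun m : E => c.Φ.symm (e.symm m, (0 : C)))
        {m | (e.symm m, (0 : C)) ∈ c.Φ.target} :=
      c.Φ.symm.continuousOn.comp (by fun_prop) fun m hm => hm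
    refine h.congr fun m hm => ?_
    have hm' : (e.symm m, (0 : C)) ∈ c.Φ.target := hm
    simp [hm']

theorem subsetChart_symm_val (c : AdaptedChart A B C S π) (x₀ : S) (e : (A × B) ≃L[ℂ] E)
    {m : E} (hm : (e.symm m, (0 : C)) ∈ c.Φ.target) :
    ((c.subsetChart x₀ e).symm m).1 = c.Φ.symm (e.symm m, 0) := by
  classical
  change (dite _ _ _ : S).1 = _
  rw [dif_pos hm]

theorem contDiffOn_subsetChart_trans (c c' : AdaptedChart A B C S π) (x₀ x₁ : S)
    (e : (A × B) ≃L[ℂ] E) :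
    ContDiffOn ℂ ω ((c.subsetChart x₀ e).symm.trans (c'.subsetChart x₁ e))
      ((c.subsetChart x₀ e).symm.trans (c'.subsetChart x₁ e)).source := by
  have h1 : ContDiffOn ℂ ω (fun m : E => c.Φ.symm (e.symm m, (0 : C)))
      {m | (e.symm m, (0 : C)) ∈ c.Φ.target} :=
    c.contDiffOn_symm.comp (by fun_prop) fun m hm => hm
  have hsub : ∀ m ∈ ((c.subsetChart x₀ e).symm.trans (c'.subsetChart x₁ e)).source,
      (e.symm m, (0 : C)) ∈ c.Φ.target ∧ c.Φ.symm (e.symm m, (0 : C)) ∈ c'.Φ.source := by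
    intro m hm
    rw [OpenPartialHomeomorph.trans_source] at hm
    refine ⟨hm.1, ?_⟩
    have := hm.2
    rw [← c.subsetChart_symm_val x₀ e hm.1]
    exact this
  have h2 := c'.contDiffOn.comp (h1.mono fun m hm => (hsub m hm).1) fun m hm => (hsub m hm).2
  refine (e.contDiff.comp_contDiffOn h2.fst).congr fun m hm => ?_
  simp only [OpenPartialHomeomorph.coe_trans, Function.comp_apply]
  change e (c'.Φ _).1 = _
  rw [c.subsetChart_symm_val x₀ e (hsub m hm).1]

section Quotient

variable [TopologicalSpace Q]

open Classical in
/-- The chart of the quotient induced by an adapted chart. -/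
noncomputable def quotientChart (c : AdaptedChart A B C S π) (x₀ : S) (hπ : IsOpenQuotientMap π) :
    OpenPartialHomeomorph Q A where
  -- By `fiber_iff` the value does not depend on the representative chosen in the source; `0` is a
  -- dummy value.
  toFun q := if h : ∃ y : S, y.1 ∈ c.Φ.source ∧ π y = q then (c.Φ h.choose.1).1.1 else 0
  invFun a := if h : ∃ b : B, ((a, b), (0 : C)) ∈ c.Φ.target then
    π ⟨_, c.symm_mem h.choose_spec⟩ else π x₀
  source := π '' {y | y.1 ∈ c.Φ.source}
  target := {a | ∃ b : B, ((a, b), (0 : C)) ∈ c.Φ.target}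
  map_source' q hq := by
    have h : ∃ y : S, y.1 ∈ c.Φ.source ∧ π y = q := hq
    rw [dif_pos h]
    refine ⟨(c.Φ h.choose.1).1.2, ?_⟩
    have := c.Φ.map_source h.choose_spec.1
    rwa [c.apply_eq _ h.choose_spec.1] at this
  map_target' a ha := by
    have h : ∃ b : B, ((a, b), (0 : C)) ∈ c.Φ.target := ha
    rw [dif_pos h]
    exact ⟨_, c.Φ.map_target h.choose_spec, rfl⟩
  left_inv' q hq := by
    have h : ∃ y : S, y.1 ∈ c.Φ.source ∧ π y = q := hq
    have h' : ∃ b : B, (((c.Φ h.choose.1).1.1, b), (0 : C)) ∈ c.Φ.target := by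
      refine ⟨(c.Φ h.choose.1).1.2, ?_⟩
      have := c.Φ.map_source h.choose_spec.1
      rwa [c.apply_eq _ h.choose_spec.1] at this
    simp only [dif_pos h, dif_pos h']
    conv_rhs => rw [← h.choose_spec.2]
    rw [c.fiber_iff _ _ (c.Φ.map_target h'.choose_spec) h.choose_spec.1]
    simp only
    rw [c.Φ.right_inv h'.choose_spec]
  right_inv' a ha := by
    have h : ∃ b : B, ((a, b), (0 : C)) ∈ c.Φ.target := ha
    have hs := c.Φ.map_target h.choose_spec
    have h' : ∃ y : S, y.1 ∈ c.Φ.source ∧ π y = π ⟨_, c.symm_mem h.choose_spec⟩ := ⟨_, hs, rfl⟩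
    simp only [dif_pos h, dif_pos h']
    rw [(c.fiber_iff _ _ h'.choose_spec.1 hs).1 h'.choose_spec.2]
    simp only
    rw [c.Φ.right_inv h.choose_spec]
  open_source := hπ.isOpenMap _ (c.Φ.open_source.preimage continuous_subtype_val)
  open_target := by
    have : {a : A | ∃ b : B, ((a, b), (0 : C)) ∈ c.Φ.target} =
        Prod.fst '' ((fun p : A × B => (p, (0 : C))) ⁻¹' c.Φ.target) := by
      ext a; simp
    rw [this]
    exact isOpenMap_fst _ (c.Φ.open_target.preimage (by fun_prop))
  continuousOn_toFun := by
    rintro _ ⟨y, hy, rfl⟩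
    refine ContinuousAt.continuousWithinAt ?_
    rw [← hπ.continuousAt_comp_iff]
    have h : ContinuousAt (fun y : S => (c.Φ y.1).1.1) y :=
      continuousAt_fst.comp (continuousAt_fst.comp
        ((c.Φ.continuousAt hy).comp continuous_subtype_val.continuousAt))
    refine h.congr ?_
    filter_upwards [(c.Φ.open_source.preimage continuous_subtype_val).mem_nhds hy] with z hz
    have h' : ∃ y : S, y.1 ∈ c.Φ.source ∧ π y = π z := ⟨z, hz, rfl⟩
    simp only [Function.comp_apply, dif_pos h']
    exact (c.fiber_iff _ _ hz h'.choose_spec.1).1 h'.choose_spec.2.symm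
  continuousOn_invFun := by
    rintro a ⟨b, hb⟩
    refine ContinuousAt.continuousWithinAt ?_
    have hU : {a' : A | ((a', b), (0 : C)) ∈ c.Φ.target} ∈ 𝓝 a :=
      (c.Φ.open_target.preimage (by fun_prop)).mem_nhds hb
    -- The chosen second coordinate may jump with `a'`. As it does not affect the class, it can be
    -- frozen at `b`, which gives a continuous local section.
    have key : ∀ a' : A, ∀ hb' : ((a', b), (0 : C)) ∈ c.Φ.target,
        (if h : ∃ b : B, ((a', b), (0 : C)) ∈ c.Φ.target then
          π ⟨_, c.symm_mem h.choose_spec⟩ else π x₀) = π ⟨_, c.symm_mem hb'⟩ := by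
      intro a' hb'
      have h : ∃ b : B, ((a', b), (0 : C)) ∈ c.Φ.target := ⟨b, hb'⟩
      rw [dif_pos h, c.fiber_iff _ _ (c.Φ.map_target h.choose_spec) (c.Φ.map_target hb')]
      simp only
      rw [c.Φ.right_inv h.choose_spec, c.Φ.right_inv hb']
    have hc : ContinuousAt (fun a' : A => if h : ((a', b), (0 : C)) ∈ c.Φ.target then
        (⟨_, c.symm_mem h⟩ : S) else x₀) a := by
      rw [Topology.IsInducing.subtypeVal.continuousAt_iff]
      have : ContinuousAt (fun a' : A => c.Φ.symm ((a', b), (0 : C))) a :=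
        ContinuousAt.comp (f := fun a' : A => ((a', b), (0 : C))) (c.Φ.symm.continuousAt hb)
          (by fun_prop)
      refine this.congr ?_
      filter_upwards [hU] with a' ha'
      have ha' : ((a', b), (0 : C)) ∈ c.Φ.target := ha'
      simp [ha']
    refine (hπ.continuous.continuousAt.comp hc).congr ?_
    filter_upwards [hU] with a' ha'
    have ha' : ((a', b), (0 : C)) ∈ c.Φ.target := ha'
    rw [key a' ha']
    simp [ha']

theorem quotientChart_apply (c : AdaptedChart A B C S π) (x₀ : S) (hπ : IsOpenQuotientMap π)
    (y : S) (hy : y.1 ∈ c.Φ.source) : c.quotientChart x₀ hπ (π y) = (c.Φ y.1).1.1 := by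
  have h : ∃ z : S, z.1 ∈ c.Φ.source ∧ π z = π y := ⟨y, hy, rfl⟩
  classical
  change (dite _ _ _ : A) = _
  rw [dif_pos h]
  exact (c.fiber_iff _ _ h.choose_spec.1 hy).1 h.choose_spec.2

theorem quotientChart_symm_apply (c : AdaptedChart A B C S π) (x₀ : S)
    (hπ : IsOpenQuotientMap π) {a : A} {b : B} (hb : ((a, b), (0 : C)) ∈ c.Φ.target) :
    (c.quotientChart x₀ hπ).symm a = π ⟨_, c.symm_mem hb⟩ := by
  have h := c.quotientChart_apply x₀ hπ ⟨_, c.symm_mem hb⟩ (c.Φ.map_target hb)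
  simp only at h
  rw [c.Φ.right_inv hb] at h
  simp only at h
  have hs : π ⟨_, c.symm_mem hb⟩ ∈ (c.quotientChart x₀ hπ).source := ⟨_, c.Φ.map_target hb, rfl⟩
  conv_lhs => rw [← h]
  exact (c.quotientChart x₀ hπ).left_inv hs

/-- Two quotient charts may overlap although their sources in `V` contain different representatives
of the same class. The analytic map `τ` carries one representative to the other and preserves `π`,
so the transition map is locally `Φ' ∘ τ ∘ Φ⁻¹` followed by the projection to `A`. -/
theorem contDiffOn_quotientChart_trans (c c' : AdaptedChart A B C S π) (x₀ x₁ : S)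
    (hπ : IsOpenQuotientMap π)
    (hτ : ∀ y y' : S, π y = π y' → ∃ τ : V → V, ContDiff ℂ ω τ ∧ τ y = y' ∧
      ∀ z : S, ∃ h : τ z ∈ S, π ⟨τ z, h⟩ = π z) :
    ContDiffOn ℂ ω ((c.quotientChart x₀ hπ).symm.trans (c'.quotientChart x₁ hπ))
      ((c.quotientChart x₀ hπ).symm.trans (c'.quotientChart x₁ hπ)).source := by
  intro a ha
  refine ContDiffAt.contDiffWithinAt ?_
  rw [OpenPartialHomeomorph.trans_source] at ha
  obtain ⟨⟨b, hb⟩, ⟨y', hy', hyy'⟩⟩ := ha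
  rw [c.quotientChart_symm_apply x₀ hπ hb] at hyy'
  obtain ⟨τ, hτs, hτy, hτS⟩ := hτ _ _ hyy'.symm
  simp only at hτy
  have h1 : ContDiffAt ℂ ω (fun a' : A => c.Φ.symm ((a', b), (0 : C))) a :=
    ContDiffAt.comp (f := fun a' : A => ((a', b), (0 : C))) a
      (c.contDiffOn_symm.contDiffAt (c.Φ.open_target.mem_nhds hb)) (by fun_prop)
  have h2 : ContDiffAt ℂ ω (fun a' : A => τ (c.Φ.symm ((a', b), (0 : C)))) a :=
    hτs.contDiffAt.comp a h1
  have h3 : ContDiffAt ℂ ω (fun a' : A => c'.Φ (τ (c.Φ.symm ((a', b), (0 : C))))) a := by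
    refine ContDiffAt.comp a ?_ h2
    rw [hτy]
    exact c'.contDiffOn.contDiffAt (c'.Φ.open_source.mem_nhds hy')
  refine (h3.fst.fst).congr_of_eventuallyEq ?_
  have hU : {a' : A | ((a', b), (0 : C)) ∈ c.Φ.target} ∈ 𝓝 a :=
    (c.Φ.open_target.preimage (by fun_prop)).mem_nhds hb
  have hU' : ∀ᶠ a' in 𝓝 a, τ (c.Φ.symm ((a', b), (0 : C))) ∈ c'.Φ.source := by
    refine h2.continuousAt.eventually_mem (c'.Φ.open_source.mem_nhds ?_)
    rw [hτy]; exact hy'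
  filter_upwards [hU, hU'] with a' ha' hs'
  simp only [OpenPartialHomeomorph.coe_trans, Function.comp_apply]
  rw [c.quotientChart_symm_apply x₀ hπ ha']
  obtain ⟨h, hh⟩ := hτS ⟨_, c.symm_mem ha'⟩
  rw [← hh]
  exact c'.quotientChart_apply x₁ hπ ⟨_, h⟩ hs'

end Quotient

open Manifold in
/-- A subset and a quotient of it that are covered by adapted charts are analytic manifolds: the
subset is embedded, and the quotient map is a submersion. -/
theorem exists_manifold_structures [TopologicalSpace Q] (hπ : IsOpenQuotientMap π)
    (hc : ∀ x : S, ∃ c : AdaptedChart A B C S π, x.1 ∈ c.Φ.source)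
    (hτ : ∀ y y' : S, π y = π y' → ∃ τ : V → V, ContDiff ℂ ω τ ∧ τ y = y' ∧
      ∀ z : S, ∃ h : τ z ∈ S, π ⟨τ z, h⟩ = π z)
    (e : (A × B) ≃L[ℂ] E) (ε : ((A × B) × C) ≃L[ℂ] V) :
    ∃ (_ : ChartedSpace E S) (_ : ChartedSpace A Q),
      IsManifold 𝓘(ℂ, E) ω S ∧
      IsSmoothEmbedding 𝓘(ℂ, E) 𝓘(ℂ, V) ω (Subtype.val : S → V) ∧
      IsManifold 𝓘(ℂ, A) ω Q ∧ IsSubmersion 𝓘(ℂ, E) 𝓘(ℂ, A) ω π := by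
  choose c hcx using hc
  let csS : ChartedSpace E S :=
    { atlas := range fun x => (c x).subsetChart x e
      chartAt := fun x => (c x).subsetChart x e
      mem_chart_source := hcx
      chart_mem_atlas := fun x => ⟨x, rfl⟩ }
  let csQ : ChartedSpace A Q :=
    { atlas := range fun x => (c x).quotientChart x hπ
      chartAt := fun q => (c (hπ.surjective q).choose).quotientChart (hπ.surjective q).choose hπ
      mem_chart_source := fun q => ⟨_, hcx (hπ.surjective q).choose, (hπ.surjective q).choose_spec⟩
      chart_mem_atlas := fun q => ⟨_, rfl⟩ }
  have mS : IsManifold 𝓘(ℂ, E) ω S := by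
    apply isManifold_of_contDiffOn
    rintro _ _ ⟨x, rfl⟩ ⟨x', rfl⟩
    simpa using contDiffOn_subsetChart_trans (c x) (c x') x x' e
  have mQ : IsManifold 𝓘(ℂ, A) ω Q := by
    apply isManifold_of_contDiffOn
    rintro _ _ ⟨x, rfl⟩ ⟨x', rfl⟩
    simpa using contDiffOn_quotientChart_trans (c x) (c x') x x' hπ hτ
  have hchS : ∀ x, (c x).subsetChart x e ∈ IsManifold.maximalAtlas 𝓘(ℂ, E) ω S :=
    fun x => IsManifold.subset_maximalAtlas ⟨x, rfl⟩
  have hchQ : ∀ x, (c x).quotientChart x hπ ∈ IsManifold.maximalAtlas 𝓘(ℂ, A) ω Q :=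
    fun x => IsManifold.subset_maximalAtlas ⟨x, rfl⟩
  refine ⟨csS, csQ, mS, ⟨?_, Topology.IsEmbedding.subtypeVal⟩, mQ, ?_⟩
  -- In these charts the inclusion reads `m ↦ (e.symm m, 0)`, with complement `C`; `ε` only
  -- transports the chart of `V` to the model space `V`.
  · refine IsImmersionOfComplement.isImmersion (F := C) fun x => ?_
    refine IsImmersionAtOfComplement.mk_of_charts
      (((e.symm.prodCongr (ContinuousLinearEquiv.refl ℂ C))).trans ε)
      ((c x).subsetChart x e) ((c x).Φ.trans ε.toHomeomorph.toOpenPartialHomeomorph) (hcx x)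
      (by simpa using hcx x) (hchS x) ?_ ?_ ?_
    · apply StructureGroupoid.mem_maximalAtlas_of_mem_groupoid
      rw [contDiffGroupoid, mem_groupoid_of_pregroupoid]
      constructor
      · simpa [contDiffPregroupoid] using ε.contDiff.comp_contDiffOn (c x).contDiffOn
      · simpa [contDiffPregroupoid] using
          (c x).contDiffOn_symm.comp (s := ε.symm ⁻¹' (c x).Φ.target)
            ε.symm.contDiff.contDiffOn fun y hy => hy
    · intro y hy
      have hy' : y.1 ∈ (c x).Φ.source := hy
      simpa using hy'
    · intro m hm
      have hm' : (e.symm m, (0 : C)) ∈ (c x).Φ.target := by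
        have hm2 : m ∈ ((c x).subsetChart x e).target := by simpa using hm
        exact hm2
      simp [subsetChart_symm_val _ _ _ hm', (c x).Φ.right_inv hm']
  -- In these charts `π` reads as the projection `A × B → A`, with complement `B`.
  · refine IsSubmersionOfComplement.isSubmersion (F := B) fun x => ?_
    refine IsSubmersionAtOfComplement.mk_of_charts e.symm
      ((c x).subsetChart x e) ((c x).quotientChart x hπ) (hcx x) ⟨x, hcx x, rfl⟩
      (hchS x) (hchQ x) (fun y hy => ⟨y, hy, rfl⟩) ?_
    intro m hm
    have hm' : (e.symm m, (0 : C)) ∈ (c x).Φ.target := by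
        have hm2 : m ∈ ((c x).subsetChart x e).target := by simpa using hm
        exact hm2
    have hs : ((c x).subsetChart x e).symm m ∈ ((c x).subsetChart x e).source :=
      ((c x).subsetChart x e).map_target hm'
    have := quotientChart_apply (c x) x hπ _ hs
    rw [subsetChart_symm_val _ _ _ hm', (c x).Φ.right_inv hm'] at this
    simpa using this

end AdaptedChart

/-! ### Resolvents versus powers of a matrix -/

section Observability

variable {m r : ℕ} (C : Matrix (Fin r) (Fin m) ℂ) (Z : Matrix (Fin m) (Fin m) ℂ) (v : Fin m → ℂ)

/-- By Cayley–Hamilton every power of `Z` is a combination of the powers below `m`. -/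
theorem mulVec_pow_eq_zero_of_lt (h : ∀ p < m, (C * Z ^ p).mulVec v = 0) (p : ℕ) :
    (C * Z ^ p).mulVec v = 0 := by
  rcases Nat.eq_zero_or_pos m with rfl | hm
  · rw [Subsingleton.elim v 0, Matrix.mulVec_zero]
  have hdeg : (Polynomial.X ^ p %ₘ Z.charpoly).natDegree < m := by
    have h1 : Z.charpoly ≠ 1 := fun h1 => by
      have := Z.charpoly_natDegree_eq_dim
      rw [h1] at this
      simp at this
      omega
    have := Polynomial.natDegree_modByMonic_lt (Polynomial.X ^ p) Z.charpoly_monic h1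
    rwa [Z.charpoly_natDegree_eq_dim, Fintype.card_fin] at this
  rw [Z.pow_eq_aeval_mod_charpoly p, Polynomial.aeval_eq_sum_range' hdeg, Matrix.mul_sum,
    Matrix.sum_mulVec]
  refine Finset.sum_eq_zero fun q hq => ?_
  rw [Matrix.mul_smul, Matrix.smul_mulVec, h q (Finset.mem_range.1 hq), smul_zero]

/-- The vectors killed by all `C Z ^ p` form a subspace stable under `z - Z`. An injective
endomorphism of a finite-dimensional space is onto, so the subspace is also stable under the
resolvent. -/
theorem resolvent_mulVec_eq_zero (h : ∀ p, (C * Z ^ p).mulVec v = 0) {z : ℂ}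
    (hz : IsUnit (z • (1 : Matrix (Fin m) (Fin m) ℂ) - Z)) :
    (C * (z • (1 : Matrix (Fin m) (Fin m) ℂ) - Z)⁻¹).mulVec v = 0 := by
  set M := z • (1 : Matrix (Fin m) (Fin m) ℂ) - Z with hM
  have hdet := (Matrix.isUnit_iff_isUnit_det M).1 hz
  let N : Submodule ℂ (Fin m → ℂ) := ⨅ p : ℕ, LinearMap.ker (C * Z ^ p).mulVecLin
  have hN : ∀ w, w ∈ N ↔ ∀ p, (C * Z ^ p).mulVec w = 0 := fun w => by
    simp [N, Submodule.mem_iInf]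
  have hMN : ∀ w ∈ N, M.mulVecLin w ∈ N := by
    intro w hw
    rw [hN] at hw ⊢
    intro p
    rw [Matrix.mulVecLin_apply, Matrix.mulVec_mulVec, hM, Matrix.mul_sub, Matrix.mul_smul,
      Matrix.mul_one, Matrix.mul_assoc, ← pow_succ, Matrix.sub_mulVec, Matrix.smul_mulVec, hw, hw]
    simp
  have hinj : Function.Injective (M.mulVecLin.restrict hMN) := by
    intro a b hab
    have := congrArg Subtype.val hab
    exact Subtype.ext (Matrix.mulVec_injective_of_isUnit hz this)
  obtain ⟨w, hw⟩ := (LinearMap.injective_iff_surjective.1 hinj) ⟨v, (hN v).2 h⟩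
  have hw' : M.mulVec w.1 = v := congrArg Subtype.val hw
  have := (hN w.1).1 w.2 0
  rw [← hw', Matrix.mulVec_mulVec, Matrix.mul_assoc, Matrix.nonsing_inv_mul _ hdet]
  simpa using this

theorem mulVec_pow_eq_zero_of_resolvent
    (h : ∀ z : ℂ, IsUnit (z • (1 : Matrix (Fin m) (Fin m) ℂ) - Z) →
      (C * (z • (1 : Matrix (Fin m) (Fin m) ℂ) - Z)⁻¹).mulVec v = 0) (p : ℕ) :
    (C * Z ^ p).mulVec v = 0 := by
  -- This is `z D (z - Z)⁻¹ v → D v` as `z → ∞`. With `t = z⁻¹` and the adjugate in place of the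
  -- inverse, the expression is polynomial in `t`, vanishes for small `t ≠ 0` and equals `D v` at `t
  -- = 0`.
  have limit : ∀ D : Matrix (Fin r) (Fin m) ℂ,
      (∀ z : ℂ, IsUnit (z • (1 : Matrix (Fin m) (Fin m) ℂ) - Z) →
        (D * (z • (1 : Matrix (Fin m) (Fin m) ℂ) - Z)⁻¹).mulVec v = 0) → D.mulVec v = 0 := by
    intro D hD
    have hcont : Continuous fun t : ℂ => 1 - t • Z := by fun_prop
    have hdet : ∀ᶠ t : ℂ in 𝓝 0, (1 - t • Z).det ≠ 0 :=
      hcont.matrix_det.continuousAt.eventually_ne (by simp)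
    have hlim : ContinuousAt (fun t : ℂ => (D * (1 - t • Z).adjugate).mulVec v) 0 :=
      (Continuous.matrix_mulVec (continuous_const.matrix_mul hcont.matrix_adjugate)
        continuous_const).continuousAt
    have hzero : ∀ᶠ t : ℂ in 𝓝[≠] 0, (D * (1 - t • Z).adjugate).mulVec v = 0 := by
      filter_upwards [hdet.filter_mono nhdsWithin_le_nhds, self_mem_nhdsWithin] with t ht ht0
      have ht0 : t ≠ 0 := ht0
      have e : 1 - t • Z = t • (t⁻¹ • (1 : Matrix (Fin m) (Fin m) ℂ) - Z) := by
        rw [smul_sub, smul_smul, mul_inv_cancel₀ ht0, one_smul]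
      have hu : IsUnit (t⁻¹ • (1 : Matrix (Fin m) (Fin m) ℂ) - Z).det := by
        rw [e, Matrix.det_smul] at ht
        exact (right_ne_zero_of_mul ht).isUnit
      have h1 := hD t⁻¹ ((Matrix.isUnit_iff_isUnit_det _).2 hu)
      have h2 : (1 - t • Z).adjugate =
          ((1 - t • Z).det * t⁻¹) • (t⁻¹ • (1 : Matrix (Fin m) (Fin m) ℂ) - Z)⁻¹ := by
        have h3 : (1 - t • Z).adjugate = (1 - t • Z).det • (1 - t • Z)⁻¹ := by
          rw [Matrix.inv_def, smul_smul, Ring.inverse_eq_inv', mul_inv_cancel₀ ht, one_smul]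
        have h4 : (1 - t • Z)⁻¹ = t⁻¹ • (t⁻¹ • (1 : Matrix (Fin m) (Fin m) ℂ) - Z)⁻¹ := by
          apply Matrix.inv_eq_right_inv
          rw [e, Matrix.smul_mul, Matrix.mul_smul, smul_smul, mul_inv_cancel₀ ht0, one_smul,
            Matrix.mul_nonsing_inv _ hu]
        rw [h3, h4, smul_smul]
      rw [h2, Matrix.mul_smul, Matrix.smul_mulVec, h1, smul_zero]
    have := tendsto_nhds_unique (hlim.tendsto.mono_left (nhdsWithin_le_nhds (s := {0}ᶜ)))
      (tendsto_const_nhds.congr' (hzero.mono fun _ h => h.symm))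
    simpa using this
  suffices ∀ z : ℂ, IsUnit (z • (1 : Matrix (Fin m) (Fin m) ℂ) - Z) →
      ((C * Z ^ p) * (z • (1 : Matrix (Fin m) (Fin m) ℂ) - Z)⁻¹).mulVec v = 0 from limit _ this
  induction p with
  | zero => simpa using h
  | succ p ih =>
    intro z hz
    -- The identity `Z (z - Z)⁻¹ = z (z - Z)⁻¹ - 1` raises the power by one.
    have e : C * Z ^ (p + 1) * (z • (1 : Matrix (Fin m) (Fin m) ℂ) - Z)⁻¹ =
        z • (C * Z ^ p * (z • (1 : Matrix (Fin m) (Fin m) ℂ) - Z)⁻¹) - C * Z ^ p := by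
      have h1 := Matrix.mul_nonsing_inv _ ((Matrix.isUnit_iff_isUnit_det _).1 hz)
      rw [Matrix.sub_mul, Matrix.smul_mul, Matrix.one_mul, sub_eq_iff_eq_add] at h1
      rw [pow_succ, ← Matrix.mul_assoc, Matrix.mul_assoc _ Z, ← Matrix.mul_smul, h1,
        Matrix.mul_add, Matrix.mul_one]
      abel
    rw [e, Matrix.sub_mulVec, Matrix.smul_mulVec, ih z hz, limit _ ih]
    simp

end Observability

/-! ### Freeness, intertwiners and the gauge action -/

namespace VortexQuiver

variable {L : ℕ} {k n : ℕ → ℕ}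

/-- The matrix `Υ_j W_j ⋯ W_{i-1} Z_i ^ p`. -/
noncomputable def obs (x : Data L k n) (i : ℕ) (hi : i < L) (j : ℕ) (hj : j ≤ i) (p : ℕ) :
    Matrix (Fin (n j)) (Fin (k i)) ℂ :=
  chain x j i hj hi * x.Z i hi ^ p

/-- Freeness becomes the injectivity of finitely many matrices polynomial in `x`, which is what the
slice construction needs. -/
theorem isFree_iff_obs (x : Data L k n) :
    IsFree x ↔ ∀ (i : ℕ) (hi : i < L) (v : Fin (k i) → ℂ),
      (∀ (j : ℕ) (hj : j ≤ i), ∀ p < k i, (obs x i hi j hj p).mulVec v = 0) → v = 0 := by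
  refine ⟨fun h i hi v hv => h i hi v fun j hj z hz => ?_,
    fun h i hi v hv => h i hi v fun j hj p _ => ?_⟩
  · exact resolvent_mulVec_eq_zero _ _ _ (mulVec_pow_eq_zero_of_lt _ _ _ (hv j hj)) hz
  · exact mulVec_pow_eq_zero_of_resolvent _ _ _ (hv j hj) p

theorem data_ext {x y : Data L k n} (hZ : ∀ i hi, x.Z i hi = y.Z i hi)
    (hU : ∀ i hi, x.Ups i hi = y.Ups i hi) (hT : ∀ i hi, x.UpsT i hi = y.UpsT i hi)
    (hW : ∀ i hi, x.W i hi = y.W i hi) : x = y :=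
  Prod.ext (funext fun i => hZ i i.2) (Prod.ext (funext fun i => hU i i.2)
    (Prod.ext (funext fun i => hT i i.2) (funext fun i => hW i (by omega))))

/-- Families of square matrices, the ambient space of the gauge group `∏ GL(k_i, ℂ)`. -/
abbrev Gauge (L : ℕ) (k : ℕ → ℕ) : Type := (i : Fin L) → Fin (k i) → Fin (k i) → ℂ

/-- The matrix `U_i` of a family. -/
def Gauge.mat (U : Gauge L k) (i : ℕ) (hi : i < L) : Matrix (Fin (k i)) (Fin (k i)) ℂ :=
  Matrix.of (U ⟨i, hi⟩)

/-- All the matrices of the family are invertible. -/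
def Gauge.IsInv (U : Gauge L k) : Prop := ∀ i hi, IsUnit (U.mat i hi).det

/-- The family `U` intertwines the data `x` and `y`; if `U` is invertible, then `y` is the
transform of `x` by `U`. -/
structure Intertwines (x : Data L k n) (U : Gauge L k) (y : Data L k n) : Prop where
  Z : ∀ i hi, U.mat i hi * y.Z i hi = x.Z i hi * U.mat i hi
  Ups : ∀ i hi, y.Ups i hi = x.Ups i hi * U.mat i hi
  UpsT : ∀ i hi, U.mat i hi * y.UpsT i hi = x.UpsT i hi
  W : ∀ i hi, U.mat i (by omega) * y.W i hi = x.W i hi * U.mat (i + 1) hi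

namespace Intertwines

variable {x y : Data L k n} {U : Gauge L k}

theorem chain_eq (h : Intertwines x U y) (j i : ℕ) (hj : j ≤ i) (hi : i < L) :
    chain y j i hj hi = chain x j i hj hi * U.mat i hi := by
  induction i, hj using Nat.le_induction with
  | base => rw [chain_self, chain_self, h.Ups]
  | succ i hj ih =>
    rw [chain_succ _ _ _ hj, chain_succ _ _ _ hj, ih, Matrix.mul_assoc, h.W, Matrix.mul_assoc]

theorem Z_pow (h : Intertwines x U y) (i : ℕ) (hi : i < L) (p : ℕ) :
    U.mat i hi * y.Z i hi ^ p = x.Z i hi ^ p * U.mat i hi := by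
  induction p with
  | zero => simp
  | succ p ih =>
    rw [pow_succ, ← Matrix.mul_assoc, ih, Matrix.mul_assoc, h.Z, ← Matrix.mul_assoc, ← pow_succ]

theorem obs_eq (h : Intertwines x U y) (i : ℕ) (hi : i < L) (j : ℕ) (hj : j ≤ i) (p : ℕ) :
    obs y i hi j hj p = obs x i hi j hj p * U.mat i hi := by
  rw [obs, obs, h.chain_eq, Matrix.mul_assoc, h.Z_pow, Matrix.mul_assoc]

theorem constraintMatrix_eq (h : Intertwines x U y) (i : ℕ) (hi : i + 1 < L) :
    U.mat i (by omega) * constraintMatrix y i hi = constraintMatrix x i hi * U.mat (i + 1) hi := by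
  have h1 := h.Z i (by omega)
  have h2 := h.W i hi
  have h3 := h.Z (i + 1) hi
  simp only [constraintMatrix, Matrix.mul_add, Matrix.mul_sub, Matrix.add_mul, Matrix.sub_mul]
  rw [← Matrix.mul_assoc, h.UpsT, h.Ups, ← Matrix.mul_assoc, ← Matrix.mul_assoc, h1,
    ← Matrix.mul_assoc, h2, Matrix.mul_assoc (x.Z _ _), h2, Matrix.mul_assoc _ _ (y.Z _ _), h3]
  simp only [Matrix.mul_assoc]

/-- The kernel of `U_i` is killed by every `obs y = obs x * U_i`. Invertibility is thus automatic
for a free target, which saves limits of intertwiners from degenerating. -/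
theorem isInv_of_isFree (h : Intertwines x U y) (hy : IsFree y) : U.IsInv := by
  intro i hi
  rw [← Matrix.isUnit_iff_isUnit_det, ← Matrix.mulVec_injective_iff_isUnit]
  refine (injective_iff_map_eq_zero (U.mat i hi).mulVecLin).2 fun v hv => ?_
  refine (isFree_iff_obs y).1 hy i hi v fun j hj p _ => ?_
  rw [Matrix.mulVecLin_apply] at hv
  rw [h.obs_eq, ← Matrix.mulVec_mulVec, hv, Matrix.mulVec_zero]

theorem isFree (h : Intertwines x U y) (hU : U.IsInv) (hx : IsFree x) : IsFree y := by
  rw [isFree_iff_obs] at hx ⊢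
  intro i hi v hv
  have := hx i hi ((U.mat i hi).mulVec v) fun j hj p hp => by
    rw [Matrix.mulVec_mulVec, ← h.obs_eq]; exact hv j hj p hp
  have hinj := Matrix.mulVec_injective_of_isUnit ((Matrix.isUnit_iff_isUnit_det _).2 (hU i hi))
  exact hinj (by simpa using this)

theorem constraintMap_eq_zero (h : Intertwines x U y) (hU : U.IsInv) (hx : constraintMap x = 0) :
    constraintMap y = 0 := by
  funext i a b
  have hi : (i : ℕ) + 1 < L := by omega
  have hx' : constraintMatrix x i hi = 0 := by
    ext a b; exact congrFun (congrFun (congrFun hx i) a) b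
  have h1 := h.constraintMatrix_eq i hi
  rw [hx', Matrix.zero_mul] at h1
  have h2 : constraintMatrix y i hi = 0 := by
    rw [← Matrix.nonsing_inv_mul_cancel_left _ (constraintMatrix y i hi) (hU i (by omega)), h1,
      Matrix.mul_zero]
  exact congrFun (congrFun h2 a) b

theorem mem_solutionSet (h : Intertwines x U y) (hU : U.IsInv) (hx : x ∈ solutionSet L k n) :
    y ∈ solutionSet L k n :=
  ⟨h.constraintMap_eq_zero hU hx.1, h.isFree hU hx.2⟩

theorem right_unique {y' : Data L k n} (h : Intertwines x U y) (h' : Intertwines x U y')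
    (hU : U.IsInv) : y = y' := by
  refine data_ext (fun i hi => ?_) (fun i hi => ?_) (fun i hi => ?_) fun i hi => ?_
  · rw [← Matrix.nonsing_inv_mul_cancel_left _ (y.Z i hi) (hU i hi), h.Z, ← h'.Z,
      Matrix.nonsing_inv_mul_cancel_left _ _ (hU i hi)]
  · rw [h.Ups, h'.Ups]
  · rw [← Matrix.nonsing_inv_mul_cancel_left _ (y.UpsT i hi) (hU i hi), h.UpsT, ← h'.UpsT,
      Matrix.nonsing_inv_mul_cancel_left _ _ (hU i hi)]
  · rw [← Matrix.nonsing_inv_mul_cancel_left _ (y.W i hi) (hU i (by omega)), h.W, ← h'.W,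
      Matrix.nonsing_inv_mul_cancel_left _ _ (hU i (by omega))]

end Intertwines

/-- The transform of `x` by `U`. -/
noncomputable def act (x : Data L k n) (U : Gauge L k) : Data L k n :=
  (fun i => (U.mat i i.2)⁻¹ * x.Z i i.2 * U.mat i i.2,
   fun i => x.Ups i i.2 * U.mat i i.2,
   fun i => (U.mat i i.2)⁻¹ * x.UpsT i i.2,
   fun i => (U.mat i (by omega))⁻¹ * x.W i (by omega) * U.mat (i + 1) (by omega))

theorem act_Z (x : Data L k n) (U : Gauge L k) (i : ℕ) (hi : i < L) :
    (act x U).Z i hi = (U.mat i hi)⁻¹ * x.Z i hi * U.mat i hi := rfl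

theorem act_Ups (x : Data L k n) (U : Gauge L k) (i : ℕ) (hi : i < L) :
    (act x U).Ups i hi = x.Ups i hi * U.mat i hi := rfl

theorem act_UpsT (x : Data L k n) (U : Gauge L k) (i : ℕ) (hi : i < L) :
    (act x U).UpsT i hi = (U.mat i hi)⁻¹ * x.UpsT i hi := rfl

theorem act_W (x : Data L k n) (U : Gauge L k) (i : ℕ) (hi : i + 1 < L) :
    (act x U).W i hi = (U.mat i (by omega))⁻¹ * x.W i hi * U.mat (i + 1) hi := rfl

theorem intertwines_act (x : Data L k n) {U : Gauge L k} (hU : U.IsInv) :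
    Intertwines x U (act x U) where
  Z i hi := by
    rw [act_Z, Matrix.mul_assoc, Matrix.mul_nonsing_inv_cancel_left _ _ (hU i hi)]
  Ups i hi := rfl
  UpsT i hi := by rw [act_UpsT, Matrix.mul_nonsing_inv_cancel_left _ _ (hU i hi)]
  W i hi := by
    rw [act_W, Matrix.mul_assoc, Matrix.mul_nonsing_inv_cancel_left _ _ (hU i (by omega))]

theorem Intertwines.eq_act {x y : Data L k n} {U : Gauge L k} (h : Intertwines x U y)
    (hU : U.IsInv) : y = act x U :=
  h.right_unique (intertwines_act x hU) hU

theorem proj_eq_iff (x y : solutionSet L k n) :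
    proj L k n x = proj L k n y ↔ ∃ U : Gauge L k, U.IsInv ∧ Intertwines x.1 U y.1 := by
  have h0 : proj L k n x = proj L k n y ↔
      ∃ U : (i : ℕ) → i < L → GL (Fin (k i)) ℂ, IsTransform U x.1 y.1 := Quotient.eq
  rw [h0]
  constructor
  · rintro ⟨U, h1, h2, h3, h4⟩
    refine ⟨fun i => (U i i.2).val, fun i hi => (Matrix.isUnit_iff_isUnit_det _).1 (U i hi).isUnit,
      ⟨fun i hi => ?_, fun i hi => ?_, fun i hi => ?_, fun i hi => ?_⟩⟩
    · change (U i hi).val * _ = _ * (U i hi).val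
      rw [h1, Matrix.mul_assoc, ← Matrix.mul_assoc, Units.mul_inv, Matrix.one_mul]
    · exact h2 i hi
    · change (U i hi).val * y.1.UpsT i hi = x.1.UpsT i hi
      rw [h3, ← Matrix.mul_assoc, Units.mul_inv, Matrix.one_mul]
    · change (U i _).val * _ = _ * (U (i + 1) hi).val
      rw [h4, Matrix.mul_assoc, ← Matrix.mul_assoc, Units.mul_inv, Matrix.one_mul]
  · rintro ⟨U, hU, h⟩
    refine ⟨fun i hi => Matrix.nonsingInvUnit (U.mat i hi) (hU i hi), ?_⟩
    rw [h.eq_act hU]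
    exact ⟨fun i hi => rfl, fun i hi => rfl, fun i hi => rfl, fun i hi => rfl⟩

/-! ### The constraint map and its derivative -/

theorem contDiffAt_matrix_mul {V : Type*} [NormedAddCommGroup V] [NormedSpace ℂ V] {p q r : ℕ}
    {A : V → Matrix (Fin p) (Fin q) ℂ} {B : V → Matrix (Fin q) (Fin r) ℂ} {x : V}
    (hA : ∀ a b, ContDiffAt ℂ ω (fun y => A y a b) x)
    (hB : ∀ a b, ContDiffAt ℂ ω (fun y => B y a b) x) (a : Fin p) (b : Fin r) :
    ContDiffAt ℂ ω (fun y => (A y * B y) a b) x := by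
  simp only [Matrix.mul_apply]
  exact ContDiffAt.sum fun c _ => (hA a c).mul (hB c b)

theorem contDiffAt_Z (x : Data L k n) (i : ℕ) (hi : i < L) (a b : Fin (k i)) :
    ContDiffAt ℂ ω (fun y : Data L k n => y.Z i hi a b) x :=
  have h : ContDiffAt ℂ ω (fun y : Data L k n => y.1) x := by fun_prop
  contDiffAt_pi.1 (contDiffAt_pi.1 (contDiffAt_pi.1 h ⟨i, hi⟩) a) b

theorem contDiffAt_Ups (x : Data L k n) (i : ℕ) (hi : i < L) (a : Fin (n i)) (b : Fin (k i)) :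
    ContDiffAt ℂ ω (fun y : Data L k n => y.Ups i hi a b) x :=
  have h : ContDiffAt ℂ ω (fun y : Data L k n => y.2.1) x := by fun_prop
  contDiffAt_pi.1 (contDiffAt_pi.1 (contDiffAt_pi.1 h ⟨i, hi⟩) a) b

theorem contDiffAt_UpsT (x : Data L k n) (i : ℕ) (hi : i < L) (a : Fin (k i))
    (b : Fin (n (i + 1))) : ContDiffAt ℂ ω (fun y : Data L k n => y.UpsT i hi a b) x :=
  have h : ContDiffAt ℂ ω (fun y : Data L k n => y.2.2.1) x := by fun_prop
  contDiffAt_pi.1 (contDiffAt_pi.1 (contDiffAt_pi.1 h ⟨i, hi⟩) a) b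

theorem contDiffAt_W (x : Data L k n) (i : ℕ) (hi : i + 1 < L) (a : Fin (k i))
    (b : Fin (k (i + 1))) : ContDiffAt ℂ ω (fun y : Data L k n => y.W i hi a b) x :=
  have h : ContDiffAt ℂ ω (fun y : Data L k n => y.2.2.2) x := by fun_prop
  contDiffAt_pi.1 (contDiffAt_pi.1 (contDiffAt_pi.1 h ⟨i, by omega⟩) a) b

/-- The derivative of the `i`-th constraint at `x` in the direction `ξ`. -/
noncomputable def jacobianMatrix (x ξ : Data L k n) (i : ℕ) (hi : i + 1 < L) :
    Matrix (Fin (k i)) (Fin (k (i + 1))) ℂ :=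
  ξ.UpsT i (by omega) * x.Ups (i + 1) hi + x.UpsT i (by omega) * ξ.Ups (i + 1) hi
    - ξ.Z i (by omega) * x.W i hi - x.Z i (by omega) * ξ.W i hi
    + ξ.W i hi * x.Z (i + 1) hi + x.W i hi * ξ.Z (i + 1) hi

/-- The constraints are of degree two without a constant term, so the expansion along a line is
exact and the Jacobian is its linear coefficient. -/
theorem constraintMatrix_add_smul (x ξ : Data L k n) (t : ℂ) (i : ℕ) (hi : i + 1 < L) :
    constraintMatrix (x + t • ξ) i hi =
      constraintMatrix x i hi + t • jacobianMatrix x ξ i hi + t ^ 2 • constraintMatrix ξ i hi := by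
  have hZ : ∀ j hj, (x + t • ξ).Z j hj = x.Z j hj + t • ξ.Z j hj := fun _ _ => rfl
  have hU : ∀ j hj, (x + t • ξ).Ups j hj = x.Ups j hj + t • ξ.Ups j hj := fun _ _ => rfl
  have hT : ∀ j hj, (x + t • ξ).UpsT j hj = x.UpsT j hj + t • ξ.UpsT j hj := fun _ _ => rfl
  have hW : ∀ j hj, (x + t • ξ).W j hj = x.W j hj + t • ξ.W j hj := fun _ _ => rfl
  simp only [constraintMatrix, jacobianMatrix, hZ, hU, hT, hW, Matrix.add_mul, Matrix.mul_add,
    Matrix.smul_mul, Matrix.mul_smul, smul_add, smul_sub, pow_two, smul_smul]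
  abel

theorem contDiff_constraintMap :
    ContDiff ℂ ω (constraintMap : Data L k n → _) := by
  refine contDiff_pi.2 fun i => contDiff_pi.2 fun a => contDiff_pi.2 fun b => ?_
  rw [contDiff_iff_contDiffAt]
  intro x
  exact ((contDiffAt_matrix_mul (contDiffAt_UpsT x _ _) (contDiffAt_Ups x _ _) a b).sub
    (contDiffAt_matrix_mul (contDiffAt_Z x _ _) (contDiffAt_W x _ _) a b)).add
    (contDiffAt_matrix_mul (contDiffAt_W x _ _) (contDiffAt_Z x _ _) a b)

theorem fderiv_constraintMap_apply (x ξ : Data L k n) (i : Fin (L - 1)) (a : Fin (k i))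
    (b : Fin (k (i + 1))) :
    fderiv ℂ (constraintMap (L := L) (k := k) (n := n)) x ξ i a b =
      jacobianMatrix x ξ i (by omega) a b := by
  have hd := (contDiff_constraintMap (L := L) (k := k) (n := n)).differentiable (by simp) x
  have h1 := hd.hasFDerivAt.hasLineDerivAt ξ
  have h2 : HasDerivAt (fun t : ℂ => constraintMap (x + t • ξ) i a b)
      (fderiv ℂ (constraintMap (L := L) (k := k) (n := n)) x ξ i a b) 0 :=
    hasDerivAt_pi.1 (hasDerivAt_pi.1 (hasDerivAt_pi.1 h1 i) a) b
  refine h2.unique ?_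
  have h3 : (fun t : ℂ => constraintMap (x + t • ξ) i a b) = fun t : ℂ =>
      constraintMap x i a b + t * jacobianMatrix x ξ i (by omega) a b +
        t ^ 2 * constraintMap ξ i a b := by
    funext t
    exact congrFun (congrFun (constraintMatrix_add_smul x ξ t i (by omega)) a) b
  rw [h3]
  have h4 := (((hasDerivAt_id (0 : ℂ)).mul_const (jacobianMatrix x ξ i (by omega) a b)).const_add
    (constraintMap x i a b)).add
    (((hasDerivAt_id (0 : ℂ)).pow 2).mul_const (constraintMap ξ i a b))
  exact h4.congr_deriv (by simp)

theorem fderiv_constraintMap_component (x ξ : Data L k n) (i : Fin (L - 1)) (a : Fin (k i))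
    (b : Fin (k (i + 1))) :
    fderiv ℂ (fun y : Data L k n => constraintMap y i a b) x ξ =
      jacobianMatrix x ξ i (by omega) a b := by
  have hd := (contDiff_constraintMap (L := L) (k := k) (n := n)).differentiable (by simp) x
  have h1 := hasFDerivAt_pi'.1 (hasFDerivAt_pi'.1 (hasFDerivAt_pi'.1 hd.hasFDerivAt i) a) b
  rw [h1.fderiv, ← fderiv_constraintMap_apply]
  rfl

open scoped ComplexOrder in
theorem eq_zero_of_trace_mul_eq_zero {p q : ℕ} {M : Matrix (Fin p) (Fin q) ℂ}
    (h : ∀ N : Matrix (Fin q) (Fin p) ℂ, (M * N).trace = 0) : M = 0 := by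
  -- For `N = Mᴴ` the trace is the sum of the squared moduli of the entries.
  exact Matrix.trace_mul_conjTranspose_self_eq_zero_iff.1 (h M.conjTranspose)

/-! ### Linear independence of the differentials -/

section Cokernel

variable {x : Data L k n} {A : (i : ℕ) → i + 1 < L → Matrix (Fin (k (i + 1))) (Fin (k i)) ℂ}

/-- The relation `W_{i+1} A_{i+1} = A_i W_i` moves the factor `A` to the left along the chain until
it meets `Υ_j` or, for `j = 0`, `W_0`; both products vanish. -/
theorem cokernel_chain (hΥ : ∀ i hi, x.Ups (i + 1) hi * A i hi = 0)
    (h0 : ∀ hi, x.W 0 hi * A 0 hi = 0)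
    (hs : ∀ i hi, A i (by omega) * x.W i (by omega) = x.W (i + 1) hi * A (i + 1) hi)
    (i : ℕ) (hi : i + 1 < L) (j : ℕ) (hj : j ≤ i + 1) :
    chain x j (i + 1) hj hi * A i hi = 0 := by
  induction i with
  | zero =>
    rcases Nat.lt_or_ge j 1 with hj1 | hj1
    · rw [chain_succ x j 0 (by omega), Matrix.mul_assoc, h0, Matrix.mul_zero]
    · obtain rfl : j = 1 := by omega
      rw [chain_self, hΥ]
  | succ i ih =>
    rcases Nat.lt_or_ge j (i + 2) with hj1 | hj1
    · rw [chain_succ x j (i + 1) (by omega), Matrix.mul_assoc, ← hs, ← Matrix.mul_assoc,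
        ih (by omega) (by omega), Matrix.zero_mul]
    · obtain rfl : j = i + 2 := by omega
      rw [chain_self, hΥ]

/-- Since `A_i` intertwines `Z_i` and `Z_{i+1}`, the powers of `Z_{i+1}` pass through it. The
columns of `A_i` are then killed by all observables at node `i + 1`, so freeness there applies. -/
theorem cokernel_eq_zero (hx : IsFree x) (hΥ : ∀ i hi, x.Ups (i + 1) hi * A i hi = 0)
    (hZ : ∀ i hi, x.Z (i + 1) hi * A i hi = A i hi * x.Z i (by omega))
    (h0 : ∀ hi, x.W 0 hi * A 0 hi = 0)
    (hs : ∀ i hi, A i (by omega) * x.W i (by omega) = x.W (i + 1) hi * A (i + 1) hi)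
    (i : ℕ) (hi : i + 1 < L) : A i hi = 0 := by
  have hp : ∀ p, x.Z (i + 1) hi ^ p * A i hi = A i hi * x.Z i (by omega) ^ p := by
    intro p
    induction p with
    | zero => simp
    | succ p ih => rw [pow_succ, Matrix.mul_assoc, hZ, ← Matrix.mul_assoc, ih, pow_succ,
        Matrix.mul_assoc]
  refine Matrix.ext_of_mulVec_single fun a => ?_
  rw [Matrix.zero_mulVec]
  refine (isFree_iff_obs x).1 hx (i + 1) hi _ fun j hj p _ => ?_
  rw [Matrix.mulVec_mulVec, obs, Matrix.mul_assoc, hp, ← Matrix.mul_assoc,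
    cokernel_chain hΥ h0 hs i hi j hj, Matrix.zero_mul, Matrix.zero_mulVec]

end Cokernel

/-- The components of the differential of the constraint map at a free point satisfy no linear
relation. -/
theorem relation_eq_zero {x : Data L k n} (hx : IsFree x)
    (A : (i : ℕ) → i + 1 < L → Matrix (Fin (k (i + 1))) (Fin (k i)) ℂ)
    (h : ∀ ξ : Data L k n, ∑ i : Fin (L - 1),
      (A i (by omega) * jacobianMatrix x ξ i (by omega)).trace = 0)
    (i : ℕ) (hi : i + 1 < L) : A i hi = 0 := by
  refine cokernel_eq_zero hx (fun i hi => ?_) (fun i hi => ?_) (fun hi => ?_) (fun i hi => ?_) i hi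
  -- Vary `Υ̃_i`, which occurs only in the `i`-th constraint.
  · refine eq_zero_of_trace_mul_eq_zero fun N => ?_
    have hi' : i < L := by omega
    set ξ : Data L k n := (0, 0, Pi.single ⟨i, hi'⟩ N, 0) with hξ
    have hZ : ∀ j hj, ξ.Z j hj = 0 := fun _ _ => rfl
    have hU : ∀ j hj, ξ.Ups j hj = 0 := fun _ _ => rfl
    have hW : ∀ j hj, ξ.W j hj = 0 := fun _ _ => rfl
    have hT : ξ.UpsT i (by omega) = N :=
      Pi.single_eq_same (M := fun j : Fin L => Fin (k j) → Fin (n (j + 1)) → ℂ) ⟨i, hi'⟩ N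
    have hT' : ∀ j hj, j ≠ i → ξ.UpsT j hj = 0 := fun j hj hne =>
      Pi.single_eq_of_ne (i := (⟨i, by omega⟩ : Fin L)) (i' := ⟨j, hj⟩)
        (fun e => hne (Fin.mk.inj e)) _
    have h1 := h ξ
    simp only [jacobianMatrix, hZ, hU, hW, Matrix.mul_zero, Matrix.zero_mul, add_zero,
      sub_zero] at h1
    rw [Finset.sum_eq_single (⟨i, by omega⟩ : Fin (L - 1))] at h1
    · rw [Matrix.mul_assoc, Matrix.trace_mul_comm, Matrix.mul_assoc]
      simpa only [hT] using h1
    · intro j _ hj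
      rw [hT' j _ fun e => hj (Fin.ext e), Matrix.zero_mul, Matrix.mul_zero, Matrix.trace_zero]
    · simp
  -- Vary `W_i`, which also occurs only in the `i`-th constraint.
  · rw [← sub_eq_zero]
    refine eq_zero_of_trace_mul_eq_zero fun N => ?_
    have hi' : i < L - 1 := by omega
    set ξ : Data L k n := (0, 0, 0, Pi.single ⟨i, hi'⟩ N) with hξ
    have hZ : ∀ j hj, ξ.Z j hj = 0 := fun _ _ => rfl
    have hU : ∀ j hj, ξ.Ups j hj = 0 := fun _ _ => rfl
    have hT : ∀ j hj, ξ.UpsT j hj = 0 := fun _ _ => rfl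
    have hW : ξ.W i hi = N :=
      Pi.single_eq_same (M := fun j : Fin (L - 1) => Fin (k j) → Fin (k (j + 1)) → ℂ) ⟨i, hi'⟩ N
    have hW' : ∀ j hj, j ≠ i → ξ.W j hj = 0 := fun j hj hne =>
      Pi.single_eq_of_ne (i := (⟨i, by omega⟩ : Fin (L - 1))) (i' := ⟨j, by omega⟩)
        (fun e => hne (Fin.mk.inj e)) _
    have h1 := h ξ
    simp only [jacobianMatrix, hZ, hU, hT, Matrix.mul_zero, Matrix.zero_mul, add_zero,
      sub_zero, zero_sub] at h1
    rw [Finset.sum_eq_single (⟨i, by omega⟩ : Fin (L - 1))] at h1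
    · rw [Matrix.sub_mul, Matrix.trace_sub, Matrix.mul_assoc, Matrix.trace_mul_comm,
        Matrix.mul_assoc, Matrix.mul_assoc]
      simp only [hW, Matrix.mul_add, Matrix.mul_neg, Matrix.trace_add, Matrix.trace_neg] at h1
      linear_combination h1
    · intro j _ hj
      rw [hW' j _ fun e => hj (Fin.ext e)]
      simp
    · simp
  -- Vary `Z_0`: no constraint lies to its left, so a single term remains.
  · refine eq_zero_of_trace_mul_eq_zero fun N => ?_
    have hi' : 0 < L := by omega
    set ξ : Data L k n := (Pi.single ⟨0, hi'⟩ N, 0, 0, 0) with hξ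
    have hW : ∀ j hj, ξ.W j hj = 0 := fun _ _ => rfl
    have hU : ∀ j hj, ξ.Ups j hj = 0 := fun _ _ => rfl
    have hT : ∀ j hj, ξ.UpsT j hj = 0 := fun _ _ => rfl
    have hZ : ξ.Z 0 (by omega) = N :=
      Pi.single_eq_same (M := fun j : Fin L => Fin (k j) → Fin (k j) → ℂ) ⟨0, hi'⟩ N
    have hZ' : ∀ j hj, j ≠ 0 → ξ.Z j hj = 0 := fun j hj hne =>
      Pi.single_eq_of_ne (i := (⟨0, by omega⟩ : Fin L)) (i' := ⟨j, hj⟩)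
        (fun e => hne (Fin.mk.inj e)) _
    have h1 := h ξ
    have hZs : ∀ j hj, ξ.Z (j + 1) hj = 0 := fun j hj => hZ' _ _ (by omega)
    simp only [jacobianMatrix, hZs, hW, hU, hT, Matrix.mul_zero, Matrix.zero_mul, add_zero,
      sub_zero, zero_sub] at h1
    rw [Finset.sum_eq_single (⟨0, by omega⟩ : Fin (L - 1))] at h1
    · rw [Matrix.mul_assoc, Matrix.trace_mul_comm, Matrix.mul_assoc]
      simpa only [hZ, Matrix.mul_neg, Matrix.trace_neg, neg_eq_zero] using h1
    · intro j _ hj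
      rw [hZ' j _ fun e => hj (Fin.ext e)]
      simp
    · simp
  -- Vary `Z_{i+1}`, which occurs in the constraints `i` and `i + 1` with opposite signs.
  · rw [← sub_eq_zero]
    refine eq_zero_of_trace_mul_eq_zero fun N => ?_
    have hi' : i + 1 < L := by omega
    set ξ : Data L k n := (Pi.single ⟨i + 1, hi'⟩ N, 0, 0, 0) with hξ
    have hW : ∀ j hj, ξ.W j hj = 0 := fun _ _ => rfl
    have hU : ∀ j hj, ξ.Ups j hj = 0 := fun _ _ => rfl
    have hT : ∀ j hj, ξ.UpsT j hj = 0 := fun _ _ => rfl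
    have hZ : ξ.Z (i + 1) (by omega) = N :=
      Pi.single_eq_same (M := fun j : Fin L => Fin (k j) → Fin (k j) → ℂ) ⟨i + 1, hi'⟩ N
    have hZ' : ∀ j hj, j ≠ i + 1 → ξ.Z j hj = 0 := fun j hj hne =>
      Pi.single_eq_of_ne (i := (⟨i + 1, by omega⟩ : Fin L)) (i' := ⟨j, hj⟩)
        (fun e => hne (Fin.mk.inj e)) _
    have h1 := h ξ
    simp only [jacobianMatrix, hW, hU, hT, Matrix.mul_zero, Matrix.zero_mul, add_zero,
      sub_zero, zero_sub] at h1
    rw [Finset.sum_eq_add (⟨i, by omega⟩ : Fin (L - 1)) ⟨i + 1, by omega⟩ (by simp)] at h1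
    · rw [Matrix.sub_mul, Matrix.trace_sub, Matrix.mul_assoc, Matrix.mul_assoc (x.W _ _),
        Matrix.trace_mul_comm (x.W (i + 1) _), Matrix.mul_assoc]
      simp only [hZ, hZ' i _ (by omega), hZ' (i + 1 + 1) _ (by omega), Matrix.mul_neg,
        Matrix.mul_zero, Matrix.zero_mul, neg_zero, zero_add, add_zero, Matrix.trace_neg] at h1
      linear_combination h1
    · intro j _ hj
      rw [hZ' j _ fun e => hj.2 (Fin.ext e), hZ' (j + 1) _ fun e => hj.1 (Fin.ext (by simpa using e))]
      simp
    · simp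
    · simp

/-- The rows of the Jacobian of the constraint map at a free point are linearly independent. -/
theorem relation_coeff_eq_zero {x : Data L k n} (hx : IsFree x)
    (c : (i : Fin (L - 1)) × (Fin (k i) × Fin (k (i + 1))) → ℂ)
    (h : ∀ ξ : Data L k n, ∑ q, c q * jacobianMatrix x ξ q.1 (by omega) q.2.1 q.2.2 = 0) :
    c = 0 := by
  have key := relation_eq_zero hx
    -- The indices are transposed so that the trace pairing becomes the coefficientwise sum.
    (fun i hi => Matrix.of fun b a => c ⟨⟨i, by omega⟩, a, b⟩) fun ξ => by
      rw [← h ξ, Fintype.sum_sigma]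
      refine Finset.sum_congr rfl fun i _ => ?_
      rw [Fintype.sum_prod_type, Finset.sum_comm]
      rfl
  funext ⟨i, a, b⟩
  exact congrFun (congrFun (key i (by omega)) b) a

theorem linearIndependent_fderiv {x : Data L k n} (hx : IsFree x) :
    LinearIndependent ℂ (fun c : (i : Fin (L - 1)) × (Fin (k i) × Fin (k (i + 1))) =>
      fderiv ℂ (fun y : Data L k n => constraintMap y c.1 c.2.1 c.2.2) x) := by
  rw [Fintype.linearIndependent_iff]
  intro c hc q
  refine congrFun (relation_coeff_eq_zero hx c fun ξ => ?_) q
  have := congrArg (fun l : Data L k n →L[ℂ] ℂ => l ξ) hc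
  simpa [fderiv_constraintMap_component] using this

theorem linearMap_pi_apply {ι : Type*} [Fintype ι] [DecidableEq ι] {M : ι → Type*}
    [∀ i, AddCommGroup (M i)] [∀ i, Module ℂ (M i)] (φ : ((i : ι) → M i) →ₗ[ℂ] ℂ)
    (F : (i : ι) → M i) : φ F = ∑ i, (φ ∘ₗ LinearMap.single ℂ M i) (F i) := by
  conv_lhs => rw [← Finset.univ_sum_single F, map_sum]
  rfl

/-- A proper range would lie in the kernel of a nonzero functional, whose coordinates would be a
nontrivial relation among the rows. -/
theorem fderiv_constraintMap_surjective {x : Data L k n} (hx : IsFree x) :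
    Function.Surjective (fderiv ℂ (constraintMap (L := L) (k := k) (n := n)) x) := by
  set D := (fderiv ℂ (constraintMap (L := L) (k := k) (n := n)) x).toLinearMap with hD
  suffices LinearMap.range D = ⊤ from LinearMap.range_eq_top.1 this
  by_contra hne
  obtain ⟨φ, hφ, hle⟩ := Submodule.exists_le_ker_of_lt_top _ (lt_top_iff_ne_top.2 hne)
  refine hφ ?_
  let c : (i : Fin (L - 1)) × (Fin (k i) × Fin (k (i + 1))) → ℂ :=
    fun q => φ (Pi.single q.1 (Pi.single q.2.1 (Pi.single q.2.2 1)))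
  have hexp : ∀ F : (i : Fin (L - 1)) → Fin (k i) → Fin (k (i + 1)) → ℂ,
      φ F = ∑ q, c q * F q.1 q.2.1 q.2.2 := by
    intro F
    rw [linearMap_pi_apply, Fintype.sum_sigma]
    refine Finset.sum_congr rfl fun i _ => ?_
    rw [linearMap_pi_apply, Fintype.sum_prod_type]
    refine Finset.sum_congr rfl fun a _ => ?_
    rw [linearMap_pi_apply]
    refine Finset.sum_congr rfl fun b _ => ?_
    conv_lhs => rw [← mul_one (F i a b), ← smul_eq_mul, map_smul, smul_eq_mul, mul_comm]
    rfl
  have hc : c = 0 := relation_coeff_eq_zero hx c fun ξ => by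
    have h1 : φ (D ξ) = 0 := hle ⟨ξ, rfl⟩
    rw [hexp] at h1
    simpa [hD, fderiv_constraintMap_apply] using h1
  exact LinearMap.ext fun F => by simp [hexp, hc]

/-! ### Dimension counts -/

theorem finrank_constraints :
    Module.finrank ℂ ((i : Fin (L - 1)) → Fin (k i) → Fin (k (i + 1)) → ℂ) =
      numConstraints L k := by
  simp [Module.finrank_pi_fintype, numConstraints, Finset.sum_range]

theorem finrank_gauge : Module.finrank ℂ (Gauge L k) = gaugeDim L k := by
  simp [Module.finrank_pi_fintype, gaugeDim, Finset.sum_range, pow_two]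

theorem finrank_data : Module.finrank ℂ (Data L k n) =
    moduliDim L k n + (gaugeDim L k + numConstraints L k) := by
  simp only [Module.finrank_prod, Module.finrank_pi_fintype, Module.finrank_self, moduliDim,
    gaugeDim, numConstraints, Finset.sum_range, Finset.sum_const, Finset.card_univ,
    Fintype.card_fin, smul_eq_mul, mul_one, mul_add, Finset.sum_add_distrib, pow_two]
  simp only [mul_comm]
  ring

/-! ### Analyticity of the gauge action -/

section GaugeFamilies

/-- The family of identity matrices. -/
def Gauge.one (L : ℕ) (k : ℕ → ℕ) : Gauge L k := fun i => (1 : Matrix (Fin (k i)) (Fin (k i)) ℂ)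

/-- The family of inverse matrices. -/
noncomputable def Gauge.inv (U : Gauge L k) : Gauge L k :=
  fun i => ((U.mat i i.2)⁻¹ : Matrix (Fin (k i)) (Fin (k i)) ℂ)

/-- The product of two families. -/
noncomputable def Gauge.mul (U V : Gauge L k) : Gauge L k := fun i => U.mat i i.2 * V.mat i i.2

theorem Gauge.one_mat (i : ℕ) (hi : i < L) : (Gauge.one L k).mat i hi = 1 := rfl

theorem Gauge.inv_mat (U : Gauge L k) (i : ℕ) (hi : i < L) : U.inv.mat i hi = (U.mat i hi)⁻¹ := rfl

theorem Gauge.mul_mat (U V : Gauge L k) (i : ℕ) (hi : i < L) :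
    (U.mul V).mat i hi = U.mat i hi * V.mat i hi := rfl

theorem Gauge.ext_mat {U V : Gauge L k} (h : ∀ i hi, U.mat i hi = V.mat i hi) : U = V :=
  funext fun i => h i i.2

theorem Gauge.isInv_one : (Gauge.one L k).IsInv := fun i hi => by simp [Gauge.one_mat]

theorem Gauge.inv_one : (Gauge.one L k).inv = Gauge.one L k :=
  Gauge.ext_mat fun i hi => by simp [Gauge.one_mat, Gauge.inv_mat]

theorem Gauge.IsInv.inv {U : Gauge L k} (h : U.IsInv) : U.inv.IsInv := fun i hi => by
  rw [Gauge.inv_mat]; exact Matrix.isUnit_nonsing_inv_det _ (h i hi)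

theorem Intertwines.trans {x y z : Data L k n} {U V : Gauge L k} (h : Intertwines x U y)
    (h' : Intertwines y V z) : Intertwines x (U.mul V) z where
  Z i hi := by
    rw [Gauge.mul_mat, Matrix.mul_assoc, h'.Z, ← Matrix.mul_assoc, h.Z, Matrix.mul_assoc]
  Ups i hi := by rw [Gauge.mul_mat, h'.Ups, h.Ups, Matrix.mul_assoc]
  UpsT i hi := by rw [Gauge.mul_mat, Matrix.mul_assoc, h'.UpsT, h.UpsT]
  W i hi := by
    rw [Gauge.mul_mat, Gauge.mul_mat, Matrix.mul_assoc, h'.W, ← Matrix.mul_assoc, h.W,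
      Matrix.mul_assoc]

theorem act_one (x : Data L k n) : act x (Gauge.one L k) = x :=
  ((⟨fun i hi => by simp [Gauge.one_mat], fun i hi => by simp [Gauge.one_mat],
    fun i hi => by simp [Gauge.one_mat], fun i hi => by simp [Gauge.one_mat]⟩ :
    Intertwines x (Gauge.one L k) x).eq_act Gauge.isInv_one).symm

theorem contDiffAt_mat (U : Gauge L k) (i : ℕ) (hi : i < L) (a b : Fin (k i)) :
    ContDiffAt ℂ ω (fun V : Gauge L k => V.mat i hi a b) U :=
  have h : ContDiffAt ℂ ω (fun V : Gauge L k => V) U := contDiffAt_id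
  contDiffAt_pi.1 (contDiffAt_pi.1 (contDiffAt_pi.1 h ⟨i, hi⟩) a) b

theorem continuous_mat (i : ℕ) (hi : i < L) : Continuous fun V : Gauge L k => V.mat i hi :=
  continuous_apply (⟨i, hi⟩ : Fin L)

theorem isOpen_isInv : IsOpen {U : Gauge L k | U.IsInv} := by
  have : {U : Gauge L k | U.IsInv} = ⋂ i : Fin L, {U | (U.mat i i.2).det ≠ 0} := by
    ext U
    simp only [mem_iInter, mem_ofPred_eq, Gauge.IsInv, isUnit_iff_ne_zero]
    exact ⟨fun h i => h i i.2, fun h i hi => h ⟨i, hi⟩⟩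
  rw [this]
  exact isOpen_iInter_of_finite fun i =>
    isOpen_ne_fun (continuous_mat (i : ℕ) i.2).matrix_det continuous_const

theorem contDiffAt_det {V : Type*} [NormedAddCommGroup V] [NormedSpace ℂ V] {m : ℕ}
    {M : V → Matrix (Fin m) (Fin m) ℂ} {x : V}
    (hM : ∀ a b, ContDiffAt ℂ ω (fun y => M y a b) x) :
    ContDiffAt ℂ ω (fun y => (M y).det) x := by
  simp only [Matrix.det_apply']
  exact ContDiffAt.sum fun σ _ => contDiffAt_const.mul (contDiffAt_prod fun i _ => hM _ _)

/-- Cramer's rule: an entry of the adjugate is the determinant of the matrix with one row replaced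
by a constant vector. -/
theorem contDiffAt_matrix_inv {V : Type*} [NormedAddCommGroup V] [NormedSpace ℂ V] {m : ℕ}
    {M : V → Matrix (Fin m) (Fin m) ℂ} {x : V}
    (hM : ∀ a b, ContDiffAt ℂ ω (fun y => M y a b) x) (hx : IsUnit (M x).det) (a b : Fin m) :
    ContDiffAt ℂ ω (fun y => (M y)⁻¹ a b) x := by
  simp only [Matrix.inv_def, Matrix.smul_apply, Matrix.adjugate_apply, smul_eq_mul,
    Ring.inverse_eq_inv']
  refine ((contDiffAt_det hM).inv hx.ne_zero).mul (contDiffAt_det fun c d => ?_)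
  by_cases h : c = b
  · subst h
    simp only [Matrix.updateRow_self]
    exact contDiffAt_const
  · simp only [Matrix.updateRow_ne h]
    exact hM c d

theorem contDiffAt_gauge_inv {U : Gauge L k} (hU : U.IsInv) :
    ContDiffAt ℂ ω (Gauge.inv : Gauge L k → Gauge L k) U :=
  contDiffAt_pi.2 fun i => contDiffAt_pi.2 fun a => contDiffAt_pi.2 fun b =>
    contDiffAt_matrix_inv (contDiffAt_mat U i i.2) (hU i i.2) a b

theorem contDiffAt_snd_mat (q : Data L k n × Gauge L k) (i : ℕ) (hi : i < L) (a b : Fin (k i)) :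
    ContDiffAt ℂ ω (fun p : Data L k n × Gauge L k => p.2.mat i hi a b) q :=
  (contDiffAt_mat q.2 i hi a b).comp q contDiffAt_snd

theorem contDiffAt_act_Z {q : Data L k n × Gauge L k} (hU : q.2.IsInv) (i : ℕ) (hi : i < L)
    (a b : Fin (k i)) :
    ContDiffAt ℂ ω (fun p : Data L k n × Gauge L k => (act p.1 p.2).Z i hi a b) q := by
  have h : ∀ a b, ContDiffAt ℂ ω (fun p : Data L k n × Gauge L k => p.1.Z i hi a b) q :=
    fun a b => (contDiffAt_Z q.1 i hi a b).comp q contDiffAt_fst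
  simp only [act_Z]
  exact contDiffAt_matrix_mul (contDiffAt_matrix_mul
    (contDiffAt_matrix_inv (contDiffAt_snd_mat q i hi) (hU i hi)) h) (contDiffAt_snd_mat q i hi) a b

theorem contDiffAt_act_Ups (q : Data L k n × Gauge L k) (i : ℕ) (hi : i < L)
    (a : Fin (n i)) (b : Fin (k i)) :
    ContDiffAt ℂ ω (fun p : Data L k n × Gauge L k => (act p.1 p.2).Ups i hi a b) q := by
  have h : ∀ a b, ContDiffAt ℂ ω (fun p : Data L k n × Gauge L k => p.1.Ups i hi a b) q :=
    fun a b => (contDiffAt_Ups q.1 i hi a b).comp q contDiffAt_fst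
  simp only [act_Ups]
  exact contDiffAt_matrix_mul h (contDiffAt_snd_mat q i hi) a b

theorem contDiffAt_act_UpsT {q : Data L k n × Gauge L k} (hU : q.2.IsInv) (i : ℕ) (hi : i < L)
    (a : Fin (k i)) (b : Fin (n (i + 1))) :
    ContDiffAt ℂ ω (fun p : Data L k n × Gauge L k => (act p.1 p.2).UpsT i hi a b) q := by
  have h : ∀ a b, ContDiffAt ℂ ω (fun p : Data L k n × Gauge L k => p.1.UpsT i hi a b) q :=
    fun a b => (contDiffAt_UpsT q.1 i hi a b).comp q contDiffAt_fst
  simp only [act_UpsT]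
  exact contDiffAt_matrix_mul
    (contDiffAt_matrix_inv (contDiffAt_snd_mat q i hi) (hU i hi)) h a b

theorem contDiffAt_act_W {q : Data L k n × Gauge L k} (hU : q.2.IsInv) (i : ℕ) (hi : i + 1 < L)
    (a : Fin (k i)) (b : Fin (k (i + 1))) :
    ContDiffAt ℂ ω (fun p : Data L k n × Gauge L k => (act p.1 p.2).W i hi a b) q := by
  have h : ∀ a b, ContDiffAt ℂ ω (fun p : Data L k n × Gauge L k => p.1.W i hi a b) q :=
    fun a b => (contDiffAt_W q.1 i hi a b).comp q contDiffAt_fst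
  simp only [act_W]
  exact contDiffAt_matrix_mul (contDiffAt_matrix_mul
    (contDiffAt_matrix_inv (contDiffAt_snd_mat q i (by omega)) (hU i (by omega))) h)
    (contDiffAt_snd_mat q (i + 1) hi) a b

theorem contDiffAt_act (x : Data L k n) {U : Gauge L k} (hU : U.IsInv) :
    ContDiffAt ℂ ω (fun p : Data L k n × Gauge L k => act p.1 p.2) (x, U) := by
  have h1 : ContDiffAt ℂ ω (fun p : Data L k n × Gauge L k => (act p.1 p.2).1) (x, U) :=
    contDiffAt_pi.2 fun i => contDiffAt_pi.2 fun a => contDiffAt_pi.2 fun b =>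
      contDiffAt_act_Z (q := (x, U)) hU i i.2 a b
  have h2 : ContDiffAt ℂ ω (fun p : Data L k n × Gauge L k => (act p.1 p.2).2.1) (x, U) :=
    contDiffAt_pi.2 fun i => contDiffAt_pi.2 fun a => contDiffAt_pi.2 fun b =>
      contDiffAt_act_Ups (x, U) i i.2 a b
  have h3 : ContDiffAt ℂ ω (fun p : Data L k n × Gauge L k => (act p.1 p.2).2.2.1) (x, U) :=
    contDiffAt_pi.2 fun i => contDiffAt_pi.2 fun a => contDiffAt_pi.2 fun b =>
      contDiffAt_act_UpsT (q := (x, U)) hU i i.2 a b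
  have h4 : ContDiffAt ℂ ω (fun p : Data L k n × Gauge L k => (act p.1 p.2).2.2.2) (x, U) :=
    contDiffAt_pi.2 fun i => contDiffAt_pi.2 fun a => contDiffAt_pi.2 fun b =>
      contDiffAt_act_W (q := (x, U)) hU i (by omega) a b
  exact h1.prodMk (h2.prodMk (h3.prodMk h4))

theorem contDiff_act_left {U : Gauge L k} (hU : U.IsInv) :
    ContDiff ℂ ω fun x : Data L k n => act x U :=
  contDiff_iff_contDiffAt.2 fun x => (contDiffAt_act x hU).comp x
    (contDiffAt_id.prodMk contDiffAt_const)

/-- The intertwining equations contain no inverses, so they are closed conditions even across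
singular `U`. -/
theorem isClosed_intertwines :
    IsClosed {p : Data L k n × Gauge L k × Data L k n | Intertwines p.1 p.2.1 p.2.2} := by
  have hZ : ∀ i hi, Continuous fun x : Data L k n => x.Z i hi := fun i hi =>
    (continuous_apply (⟨i, hi⟩ : Fin L)).comp continuous_fst
  have hΥ : ∀ i hi, Continuous fun x : Data L k n => x.Ups i hi := fun i hi =>
    (continuous_apply (⟨i, hi⟩ : Fin L)).comp (continuous_fst.comp continuous_snd)
  have hT : ∀ i hi, Continuous fun x : Data L k n => x.UpsT i hi := fun i hi =>
    (continuous_apply (⟨i, hi⟩ : Fin L)).comp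
      (continuous_fst.comp (continuous_snd.comp continuous_snd))
  have hW : ∀ i hi, Continuous fun x : Data L k n => x.W i hi := fun i hi =>
    (continuous_apply (⟨i, by omega⟩ : Fin (L - 1))).comp
      (continuous_snd.comp (continuous_snd.comp continuous_snd))
  have hU := continuous_mat (L := L) (k := k)
  have c1 : Continuous fun p : Data L k n × Gauge L k × Data L k n => p.1 := continuous_fst
  have c2 : Continuous fun p : Data L k n × Gauge L k × Data L k n => p.2.1 :=
    continuous_fst.comp continuous_snd
  have c3 : Continuous fun p : Data L k n × Gauge L k × Data L k n => p.2.2 :=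
    continuous_snd.comp continuous_snd
  have : {p : Data L k n × Gauge L k × Data L k n | Intertwines p.1 p.2.1 p.2.2} =
      {p | ∀ i hi, p.2.1.mat i hi * p.2.2.Z i hi = p.1.Z i hi * p.2.1.mat i hi} ∩
      ({p | ∀ i hi, p.2.2.Ups i hi = p.1.Ups i hi * p.2.1.mat i hi} ∩
      ({p | ∀ i hi, p.2.1.mat i hi * p.2.2.UpsT i hi = p.1.UpsT i hi} ∩
      {p | ∀ i hi, p.2.1.mat i (by omega) * p.2.2.W i hi =
        p.1.W i hi * p.2.1.mat (i + 1) hi})) := by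
    ext p
    exact ⟨fun h => ⟨h.Z, h.Ups, h.UpsT, h.W⟩, fun h => ⟨h.1, h.2.1, h.2.2.1, h.2.2.2⟩⟩
  rw [this]
  refine IsClosed.inter ?_ (IsClosed.inter ?_ (IsClosed.inter ?_ ?_)) <;>
    · simp only [ofPred_forall]
      refine isClosed_iInter fun i => isClosed_iInter fun hi => ?_
      first
      | exact isClosed_eq (((hU i hi).comp c2).matrix_mul ((hZ i hi).comp c3))
          (((hZ i hi).comp c1).matrix_mul ((hU i hi).comp c2))
      | exact isClosed_eq ((hΥ i hi).comp c3) (((hΥ i hi).comp c1).matrix_mul ((hU i hi).comp c2))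
      | exact isClosed_eq (((hU i hi).comp c2).matrix_mul ((hT i hi).comp c3)) ((hT i hi).comp c1)
      | exact isClosed_eq (((hU i (by omega)).comp c2).matrix_mul ((hW i hi).comp c3))
          (((hW i hi).comp c1).matrix_mul ((hU (i + 1) hi).comp c2))

end GaugeFamilies

/-! ### Equivariant slices and normal forms of orbits -/

section Slice

/-- The space of values of the matrices `Υ_j W_j ⋯ W_{i-1} Z_i ^ p` with `j ≤ i` and `p < k i` on
a vector. -/
abbrev ObsSpace (k n : ℕ → ℕ) (i : ℕ) : Type :=
  (j : Fin (i + 1)) → Fin (k i) → Fin (n j) → ℂ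

/-- The observability map at the node `i`. -/
noncomputable def obsMap (x : Data L k n) (i : ℕ) (hi : i < L) :
    (Fin (k i) → ℂ) →ₗ[ℂ] ObsSpace k n i :=
  LinearMap.pi fun j => LinearMap.pi fun p =>
    (obs x i hi j (Nat.lt_succ_iff.1 j.2) p).mulVecLin

theorem obsMap_apply (x : Data L k n) (i : ℕ) (hi : i < L) (v : Fin (k i) → ℂ)
    (j : Fin (i + 1)) (p : Fin (k i)) :
    obsMap x i hi v j p = (obs x i hi j (Nat.lt_succ_iff.1 j.2) p).mulVec v := rfl

theorem isFree_iff_obsMap (x : Data L k n) :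
    IsFree x ↔ ∀ i hi, Function.Injective (obsMap x i hi) := by
  rw [isFree_iff_obs]
  refine forall₂_congr fun i hi => ?_
  rw [injective_iff_map_eq_zero]
  refine forall_congr' fun v => ⟨fun h hv => h fun j hj p hp => ?_, fun h hv => h ?_⟩
  · exact congrFun (congrFun hv ⟨j, Nat.lt_succ_iff.2 hj⟩) ⟨p, hp⟩
  · funext j p
    exact hv j _ p p.2

theorem Intertwines.obsMap_eq {x y : Data L k n} {U : Gauge L k} (h : Intertwines x U y)
    (i : ℕ) (hi : i < L) (v : Fin (k i) → ℂ) :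
    obsMap y i hi v = obsMap x i hi ((U.mat i hi).mulVec v) := by
  funext j p
  rw [obsMap_apply, obsMap_apply, h.obs_eq, Matrix.mulVec_mulVec]

variable (P : (i : ℕ) → i < L → ObsSpace k n i →ₗ[ℂ] (Fin (k i) → ℂ))

/-- The square matrices obtained from the observability maps by composition with linear maps. -/
noncomputable def slice (x : Data L k n) : Gauge L k :=
  fun i => LinearMap.toMatrix' (P i i.2 ∘ₗ obsMap x i i.2)

theorem slice_mat (x : Data L k n) (i : ℕ) (hi : i < L) :
    (slice P x).mat i hi = LinearMap.toMatrix' (P i hi ∘ₗ obsMap x i hi) := rfl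

theorem slice_mulVec (x : Data L k n) (i : ℕ) (hi : i < L) (v : Fin (k i) → ℂ) :
    ((slice P x).mat i hi).mulVec v = P i hi (obsMap x i hi v) := by
  rw [slice_mat, LinearMap.toMatrix'_mulVec]; rfl

theorem Intertwines.slice_eq {x y : Data L k n} {U : Gauge L k} (h : Intertwines x U y) :
    slice P y = (slice P x).mul U :=
  Gauge.ext_mat fun i hi => Matrix.ext_of_mulVec_single fun b => by
    rw [Gauge.mul_mat, ← Matrix.mulVec_mulVec, slice_mulVec, slice_mulVec, h.obsMap_eq]

/-- An invertible `P ∘ O` forces `O` to be injective; thus freeness is automatic on the open set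
where the slice matrices are invertible. -/
theorem isFree_of_slice {x : Data L k n} (h : (slice P x).IsInv) : IsFree x := by
  rw [isFree_iff_obsMap]
  intro i hi v w hvw
  apply Matrix.mulVec_injective_of_isUnit ((Matrix.isUnit_iff_isUnit_det _).2 (h i hi))
  rw [slice_mulVec, slice_mulVec, hvw]

theorem exists_slice_eq_one {x : Data L k n} (hx : IsFree x) :
    ∃ P : (i : ℕ) → i < L → ObsSpace k n i →ₗ[ℂ] (Fin (k i) → ℂ), slice P x = Gauge.one L k := by
  rw [isFree_iff_obsMap] at hx
  choose P hP using fun i hi =>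
    (obsMap x i hi).exists_leftInverse_of_injective (LinearMap.ker_eq_bot.2 (hx i hi))
  refine ⟨P, Gauge.ext_mat fun i hi => ?_⟩
  rw [slice_mat, hP, LinearMap.toMatrix'_id, Gauge.one_mat]

theorem contDiffAt_obs (x : Data L k n) (i : ℕ) (hi : i < L) (j : ℕ) (hj : j ≤ i) (p : ℕ)
    (a : Fin (n j)) (b : Fin (k i)) :
    ContDiffAt ℂ ω (fun y : Data L k n => obs y i hi j hj p a b) x := by
  have hc : ∀ a b, ContDiffAt ℂ ω (fun y : Data L k n => chain y j i hj hi a b) x := by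
    clear b
    induction i, hj using Nat.le_induction with
    | base =>
      simp only [chain_self]
      exact contDiffAt_Ups x j hi
    | succ i hj ih =>
      simp only [chain_succ _ _ _ hj]
      exact contDiffAt_matrix_mul (ih _) (contDiffAt_W x i hi)
  have hp : ∀ a b, ContDiffAt ℂ ω (fun y : Data L k n => (y.Z i hi ^ p) a b) x := by
    clear a b hc
    induction p with
    | zero => simp only [pow_zero]; exact fun a b => contDiffAt_const
    | succ p ih =>
      simp only [pow_succ]
      exact contDiffAt_matrix_mul ih (contDiffAt_Z x i hi)
  exact contDiffAt_matrix_mul hc hp a b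

theorem contDiff_slice : ContDiff ℂ ω (slice P : Data L k n → Gauge L k) := by
  refine contDiff_iff_contDiffAt.2 fun x => contDiffAt_pi.2 fun i => contDiffAt_pi.2 fun a =>
    contDiffAt_pi.2 fun b => ?_
  have h1 : ContDiffAt ℂ ω (fun y : Data L k n => obsMap y i i.2 (Pi.single b 1)) x := by
    refine contDiffAt_pi.2 fun j => contDiffAt_pi.2 fun p => contDiffAt_pi.2 fun r => ?_
    simp only [obsMap_apply, Matrix.mulVec_single_one]
    exact contDiffAt_obs x i i.2 j _ p r b
  have h2 := (LinearMap.toContinuousLinearMap (P i i.2)).contDiff.contDiffAt.comp x h1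
  refine (contDiffAt_pi.1 h2 a).congr_of_eventuallyEq (Eventually.of_forall fun y => ?_)
  change LinearMap.toMatrix' (P i i.2 ∘ₗ obsMap y i i.2) a b = _
  rw [LinearMap.toMatrix'_apply]
  simp

/-- The representative of the orbit of `x` on which `slice P` is the identity. -/
noncomputable def normalize (x : Data L k n) : Data L k n := act x (slice P x).inv

theorem intertwines_normalize {x : Data L k n} (h : (slice P x).IsInv) :
    Intertwines x (slice P x).inv (normalize P x) := intertwines_act x h.inv

theorem slice_normalize {x : Data L k n} (h : (slice P x).IsInv) :
    slice P (normalize P x) = Gauge.one L k := by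
  rw [(intertwines_normalize P h).slice_eq]
  exact Gauge.ext_mat fun i hi => by
    rw [Gauge.mul_mat, Gauge.inv_mat, Matrix.mul_nonsing_inv _ (h i hi), Gauge.one_mat]

theorem normalize_eq_self {x : Data L k n} (h : slice P x = Gauge.one L k) :
    normalize P x = x := by
  rw [normalize, h, Gauge.inv_one, act_one]

/-- From `s(y) = s(x) U` follows `U s(y)⁻¹ = s(x)⁻¹`, so both normalizations are the same transform
of `x`. -/
theorem Intertwines.normalize_eq {x y : Data L k n} {U : Gauge L k} (h : Intertwines x U y)
    (hx : (slice P x).IsInv) (hy : (slice P y).IsInv) : normalize P y = normalize P x := by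
  have h1 := h.trans (intertwines_normalize P hy)
  have h2 : U.mul (slice P y).inv = (slice P x).inv := by
    rw [h.slice_eq]
    refine Gauge.ext_mat fun i hi => ?_
    have hU : IsUnit (U.mat i hi).det := by
      have := hy i hi
      rw [h.slice_eq, Gauge.mul_mat, Matrix.det_mul] at this
      exact isUnit_of_mul_isUnit_right this
    rw [Gauge.mul_mat, Gauge.inv_mat, Gauge.inv_mat, Gauge.mul_mat, Matrix.mul_inv_rev,
      Matrix.mul_nonsing_inv_cancel_left _ _ hU]
  rw [h2] at h1
  exact h1.right_unique (intertwines_normalize P hx) hx.inv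

theorem contDiffAt_normalize {x : Data L k n} (h : (slice P x).IsInv) :
    ContDiffAt ℂ ω (normalize P : Data L k n → Data L k n) x :=
  (contDiffAt_act x h.inv).comp (f := fun y => (y, (slice P y).inv)) x
    (contDiffAt_id.prodMk ((contDiffAt_gauge_inv h).comp x (contDiff_slice P).contDiffAt))

/-- The unknown `U` is traded for `slice P y`, a continuous function of `y` alone; this permits
passing to limits. -/
theorem Intertwines.normalize_left {x y : Data L k n} {U : Gauge L k}
    (h : Intertwines x U y) (hx : (slice P x).IsInv) :
    Intertwines (normalize P x) (slice P y) y := by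
  have h1 : Intertwines (normalize P x) (slice P x) x := by
    have hn := intertwines_normalize P hx
    have := intertwines_act (normalize P x) hx
    have h2 := hn.trans this
    have h3 : (slice P x).inv.mul (slice P x) = Gauge.one L k := Gauge.ext_mat fun i hi => by
      rw [Gauge.mul_mat, Gauge.inv_mat, Matrix.nonsing_inv_mul _ (hx i hi), Gauge.one_mat]
    rw [h3] at h2
    have h4 := h2.eq_act Gauge.isInv_one
    rw [act_one] at h4
    rwa [h4] at this
  rw [h.slice_eq]
  exact h1.trans h

end Slice

/-- The space of values of the constraint map. -/
abbrev Constraints (L : ℕ) (k : ℕ → ℕ) : Type :=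
  (i : Fin (L - 1)) → Fin (k i) → Fin (k (i + 1)) → ℂ

/-! ### Submersivity of the slice and constraint maps -/

section LocalStructure

variable (P : (i : ℕ) → i < L → ObsSpace k n i →ₗ[ℂ] (Fin (k i) → ℂ))

/-- The constraint map together with the slice map. -/
noncomputable def sliceConstraint (x : Data L k n) : Gauge L k × Constraints L k :=
  (slice P x, constraintMap x)

theorem contDiff_sliceConstraint : ContDiff ℂ ω (sliceConstraint P : Data L k n → _) :=
  (contDiff_slice P).prodMk contDiff_constraintMap

theorem hasFDerivAt_sliceConstraint (x : Data L k n) :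
    HasFDerivAt (sliceConstraint P) ((fderiv ℂ (slice P) x).prod
      (fderiv ℂ (constraintMap (L := L) (k := k) (n := n)) x)) x :=
  ((contDiff_slice P).differentiable (by simp) x).hasFDerivAt.prodMk
    (contDiff_constraintMap.differentiable (by simp) x).hasFDerivAt

theorem contDiffAt_orbit (x : Data L k n) :
    ContDiffAt ℂ ω (fun U : Gauge L k => act x U) (Gauge.one L k) :=
  (contDiffAt_act x Gauge.isInv_one).comp (f := fun U : Gauge L k => (x, U)) (Gauge.one L k)
    (contDiffAt_const.prodMk contDiffAt_id)

/-- On the orbit of a solution with `s(x) = 1` the constraints stay zero and `s(x·U) = U`;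
differentiate at the identity. -/
theorem fderiv_sliceConstraint_orbit {x : Data L k n} (hx : x ∈ solutionSet L k n)
    (h1 : slice P x = Gauge.one L k) (u : Gauge L k) :
    fderiv ℂ (sliceConstraint P) x
      (fderiv ℂ (fun U : Gauge L k => act x U) (Gauge.one L k) u) = (u, 0) := by
  have hd := ((contDiffAt_orbit x).differentiableAt (by simp)).hasFDerivAt
  have hf : HasFDerivAt (sliceConstraint P) (fderiv ℂ (sliceConstraint P) x)
      (act x (Gauge.one L k)) := by
    rw [act_one]; exact (hasFDerivAt_sliceConstraint P x).differentiableAt.hasFDerivAt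
  have hcomp := hf.comp (Gauge.one L k) hd
  have heq : (sliceConstraint P ∘ fun U : Gauge L k => act x U) =ᶠ[𝓝 (Gauge.one L k)]
      fun U => (U, (0 : Constraints L k)) := by
    filter_upwards [isOpen_isInv.mem_nhds (Gauge.isInv_one (L := L) (k := k))] with U hU
    have hU : U.IsInv := hU
    have hi := intertwines_act x hU
    refine Prod.ext ?_ (hi.constraintMap_eq_zero hU hx.1)
    change slice P (act x U) = U
    rw [hi.slice_eq, h1]
    exact Gauge.ext_mat fun i hi => by rw [Gauge.mul_mat, Gauge.one_mat, Matrix.one_mul]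
  have h2 : HasFDerivAt (fun U : Gauge L k => (U, (0 : Constraints L k)))
      ((ContinuousLinearMap.id ℂ (Gauge L k)).prod 0) (Gauge.one L k) :=
    (hasFDerivAt_id _).prodMk (hasFDerivAt_const _ _)
  have h3 := hcomp.unique (h2.congr_of_eventuallyEq heq)
  exact congrArg (fun l : Gauge L k →L[ℂ] Gauge L k × Constraints L k => l u) h3

/-- A preimage under `dF` is corrected by an orbit direction, which adjusts `ds` at will and leaves
`dF` unchanged. -/
theorem fderiv_sliceConstraint_surjective {x : Data L k n} (hx : x ∈ solutionSet L k n)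
    (h1 : slice P x = Gauge.one L k) :
    Function.Surjective (fderiv ℂ (sliceConstraint P) x) := by
  rintro ⟨b, c⟩
  obtain ⟨ξ, hξ⟩ := fderiv_constraintMap_surjective hx.2 c
  refine ⟨ξ + fderiv ℂ (fun U : Gauge L k => act x U) (Gauge.one L k)
    (b - fderiv ℂ (slice P) x ξ), ?_⟩
  rw [map_add, fderiv_sliceConstraint_orbit P hx h1, (hasFDerivAt_sliceConstraint P x).fderiv,
    ContinuousLinearMap.prod_apply, hξ]
  simp

/-- On `ker ds` the factor `s(y)⁻¹` is constant to first order, so `y·s(y)⁻¹` varies like `y·1 = y`.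
-/
theorem fderiv_normalize_apply {x : Data L k n} (h1 : slice P x = Gauge.one L k) {ξ : Data L k n}
    (hξ : fderiv ℂ (sliceConstraint P) x ξ = 0) : fderiv ℂ (normalize P) x ξ = ξ := by
  have hinv : (slice P x).IsInv := by rw [h1]; exact Gauge.isInv_one
  have hs0 : fderiv ℂ (slice P) x ξ = 0 := by
    rw [(hasFDerivAt_sliceConstraint P x).fderiv, ContinuousLinearMap.prod_apply] at hξ
    exact (Prod.mk_eq_zero.1 hξ).1
  have hsl : HasFDerivAt (slice P) (fderiv ℂ (slice P) x) x :=
    ((contDiff_slice P).differentiable (by simp) x).hasFDerivAt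
  have hi := ((contDiffAt_gauge_inv hinv).differentiableAt (by simp)).hasFDerivAt.comp x hsl
  set act' : Data L k n × Gauge L k → Data L k n := fun p => act p.1 p.2 with hact'
  have hα : HasFDerivAt act' (fderiv ℂ act' (x, Gauge.one L k)) (x, Gauge.one L k) :=
    ((contDiffAt_act x Gauge.isInv_one).differentiableAt (by simp)).hasFDerivAt
  have hid : fderiv ℂ act' (x, Gauge.one L k) (ξ, 0) = ξ := by
    have h2 : HasFDerivAt (fun y : Data L k n => (y, Gauge.one L k))
        ((ContinuousLinearMap.id ℂ (Data L k n)).prod 0) x :=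
      (hasFDerivAt_id _).prodMk (hasFDerivAt_const _ _)
    have h3 := hα.comp (f := fun y : Data L k n => (y, Gauge.one L k)) x h2
    have h4 : (act' ∘ fun y : Data L k n => (y, Gauge.one L k)) = id :=
      funext fun y => act_one y
    rw [h4] at h3
    exact congrArg (fun l : Data L k n →L[ℂ] Data L k n => l ξ) (h3.unique (hasFDerivAt_id x))
  have hp := (hasFDerivAt_id x).prodMk hi
  have hα' : HasFDerivAt act' (fderiv ℂ act' (x, Gauge.one L k)) (id x, (Gauge.inv ∘ slice P) x) := by
    have : (id x, (Gauge.inv ∘ slice P) x) = (x, Gauge.one L k) := by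
      simp [h1, Gauge.inv_one]
    rw [this]
    exact hα
  have hn := hα'.comp (f := fun y => (id y, (Gauge.inv ∘ slice P) y)) x hp
  have hn' : HasFDerivAt (normalize P) _ x := hn
  rw [hn'.fderiv]
  simp [hs0, hid]

end LocalStructure

/-! ### Topology of the quotient -/

theorem exists_transform {x y : solutionSet L k n} (h : proj L k n x = proj L k n y) :
    ∃ τ : Data L k n → Data L k n, ContDiff ℂ ω τ ∧ τ x = y ∧
      ∀ z : solutionSet L k n, ∃ h : τ z ∈ solutionSet L k n,
        proj L k n ⟨τ z, h⟩ = proj L k n z := by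
  obtain ⟨U, hU, hxy⟩ := (proj_eq_iff x y).1 h
  refine ⟨fun z => act z U, contDiff_act_left hU, (hxy.eq_act hU).symm, fun z => ?_⟩
  have hz := intertwines_act z.1 hU
  exact ⟨hz.mem_solutionSet hU z.2, ((proj_eq_iff _ _).2 ⟨U, hU, hz⟩).symm⟩

/-- Each gauge transformation acts continuously on the solution set, so the saturation of an open
set is open. -/
theorem isOpenQuotientMap_proj : IsOpenQuotientMap (proj L k n) := by
  have hq : IsQuotientMap (proj L k n) := isQuotientMap_quotient_mk'
  refine ⟨hq.surjective, hq.continuous, fun O hO => ?_⟩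
  rw [← hq.isOpen_preimage, isOpen_iff_mem_nhds]
  rintro y ⟨x, hx, hxy⟩
  obtain ⟨τ, hτ, hτy, hτS⟩ := exists_transform hxy.symm
  choose hmem hproj using hτS
  have hc : Continuous fun z : solutionSet L k n => (⟨τ z, hmem z⟩ : solutionSet L k n) :=
    (hτ.continuous.comp continuous_subtype_val).subtype_mk _
  have : (fun z : solutionSet L k n => (⟨τ z, hmem z⟩ : solutionSet L k n)) ⁻¹' O ∈ 𝓝 y :=
    (hO.preimage hc).mem_nhds (by
      have : (⟨τ y, hmem y⟩ : solutionSet L k n) = x := Subtype.ext hτy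
      rwa [mem_preimage, this])
  exact mem_of_superset this fun z hz => ⟨_, hz, hproj z⟩

theorem isClosed_orbitRel :
    IsClosed {q : solutionSet L k n × solutionSet L k n | proj L k n q.1 = proj L k n q.2} := by
  refine isClosed_of_closure_subset fun q hq => ?_
  obtain ⟨P, hP⟩ := exists_slice_eq_one q.1.2.2
  have hinv : (slice P q.1.1).IsInv := by rw [hP]; exact Gauge.isInv_one
  have hslice := (contDiff_slice P).continuous
  let Θ : solutionSet L k n × solutionSet L k n → Data L k n × Gauge L k × Data L k n :=
    fun q => (normalize P q.1.1, slice P q.2.1, q.2.1)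
  have h1 : ContinuousAt Θ q := by
    have c1 : ContinuousAt
        (fun q : solutionSet L k n × solutionSet L k n => normalize P q.1.1) q :=
      ContinuousAt.comp (f := fun q : solutionSet L k n × solutionSet L k n => q.1.1)
        (contDiffAt_normalize P hinv).continuousAt (by fun_prop)
    have c2 : Continuous (fun q : solutionSet L k n × solutionSet L k n => q.2.1) := by fun_prop
    exact c1.prodMk ((hslice.comp c2).continuousAt.prodMk c2.continuousAt)
  have h2 : ∀ᶠ q' in 𝓝 q, (slice P q'.1.1).IsInv := by
    have c : Continuous (fun q : solutionSet L k n × solutionSet L k n => slice P q.1.1) :=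
      hslice.comp (by fun_prop)
    exact c.continuousAt.eventually_mem (isOpen_isInv.mem_nhds hinv)
  have h3 : ∃ᶠ q' in 𝓝 q, Θ q' ∈
      {p : Data L k n × Gauge L k × Data L k n | Intertwines p.1 p.2.1 p.2.2} := by
    refine ((mem_closure_iff_frequently.1 hq).and_eventually h2).mono fun q' hq' => ?_
    obtain ⟨U, hU, hxy⟩ := (proj_eq_iff _ _).1 hq'.1
    exact hxy.normalize_left P hq'.2
  have h4 : Intertwines (Θ q).1 (Θ q).2.1 (Θ q).2.2 :=
    isClosed_intertwines.mem_of_frequently_of_tendsto h3 h1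
  have h5 : Intertwines q.1.1 (slice P q.2.1) q.2.1 := by
    have : Intertwines (normalize P q.1.1) (slice P q.2.1) q.2.1 := h4
    rwa [normalize_eq_self P hP] at this
  -- The limiting intertwiner `slice P q.2.1` is not known beforehand to be invertible; freeness of
  -- the second point supplies this.
  exact (proj_eq_iff _ _).2 ⟨_, h5.isInv_of_isFree q.2.2.2, h5⟩

instance : T2Space (ModuliSpace L k n) :=
  (t2Space_iff_of_isOpenQuotientMap isOpenQuotientMap_proj).2 isClosed_orbitRel

instance : SecondCountableTopology (ModuliSpace L k n) :=
  (isOpenQuotientMap_proj (L := L) (k := k) (n := n)).isQuotientMap.secondCountableTopology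
    isOpenQuotientMap_proj.isOpenMap

/-! ### Adapted charts around every solution -/

theorem exists_adaptedChart (x : solutionSet L k n) :
    ∃ c : AdaptedChart (EuclideanSpace ℂ (Fin (moduliDim L k n))) (Gauge L k) (Constraints L k)
      (solutionSet L k n) (proj L k n), x.1 ∈ c.Φ.source := by
  obtain ⟨P, hP⟩ := exists_slice_eq_one x.2.2
  have hinv : (slice P x.1).IsInv := by rw [hP]; exact Gauge.isInv_one
  obtain ⟨h, Φ, hxΦ, hΦ, hΦs, hΦe⟩ := exists_straightening
    (A := EuclideanSpace ℂ (Fin (moduliDim L k n)))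
    (contDiff_sliceConstraint P).contDiffAt (contDiffAt_normalize P hinv)
    (fderiv_sliceConstraint_surjective P x.2 hP) (fun ξ => fderiv_normalize_apply P hP)
    (by rw [finrank_data, finrank_euclideanSpace_fin, Module.finrank_prod, finrank_gauge,
      finrank_constraints])
  have hD : IsOpen {y : Data L k n | (slice P y).IsInv} :=
    isOpen_isInv.preimage (contDiff_slice P).continuous
  -- Normal forms must also lie in the source of `Φ`, so that its injectivity can be applied to
  -- them.
  let O : Set (Data L k n) := {y | (slice P y).IsInv} ∩ normalize P ⁻¹' Φ.source
  have hO : IsOpen O := ContinuousOn.isOpen_inter_preimage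
    (fun y hy => (contDiffAt_normalize P hy).continuousAt.continuousWithinAt) hD Φ.open_source
  have hxO : x.1 ∈ O := ⟨hinv, by rw [mem_preimage, normalize_eq_self P hP]; exact hxΦ⟩
  let Ψ := Φ.restrOpen O hO
  have hsrc : Ψ.source = Φ.source ∩ O := Φ.restrOpen_source O hO
  have hΨ : ∀ y, Ψ y = ((h (normalize P y), slice P y), constraintMap y) := hΦe
  refine ⟨⟨Ψ, ?_, ?_, fun y hy => ?_, fun y y' hy hy' => ?_⟩, ?_⟩
  · exact hΦ.mono (by rw [hsrc]; exact inter_subset_left)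
  · refine hΦs.mono fun p hp => ?_
    exact hp.1
  · rw [hsrc] at hy
    rw [hΨ]
    -- On `O` freeness is automatic, so membership means only that the constraints vanish.
    exact ⟨fun h => h.1, fun h => ⟨h, isFree_of_slice P hy.2.1⟩⟩
  · rw [hsrc] at hy hy'
    rw [hΨ, hΨ]
    constructor
    · intro hyy
      obtain ⟨U, hU, hi⟩ := (proj_eq_iff _ _).1 hyy
      simp only
      rw [hi.normalize_eq P hy.2.1 hy'.2.1]
    · intro hyy
      simp only at hyy
      -- A normal form of a solution has the fixed coordinates `s = 1` and `F = 0`, so the first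
      -- coordinate alone determines it, and with it the orbit.
      have key : ∀ z : solutionSet L k n, z.1 ∈ O →
          Φ (normalize P z.1) = ((h (normalize P z.1), Gauge.one L k), 0) := by
        intro z hz
        have hs := slice_normalize P hz.1
        rw [hΦe, normalize_eq_self P hs]
        exact Prod.ext (Prod.ext rfl hs)
          ((intertwines_normalize P hz.1).constraintMap_eq_zero hz.1.inv z.2.1)
      have heq : normalize P y.1 = normalize P y'.1 :=
        Φ.injOn hy.2.2 hy'.2.2 (by rw [key y hy.2, key y' hy'.2, hyy])
      have hn : ∀ z : solutionSet L k n, ∀ hz : z.1 ∈ O,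
          proj L k n z = proj L k n ⟨normalize P z.1,
            (intertwines_normalize P hz.1).mem_solutionSet hz.1.inv z.2⟩ := fun z hz =>
        (proj_eq_iff _ _).2 ⟨_, hz.1.inv, intertwines_normalize P hz.1⟩
      rw [hn y hy.2, hn y' hy'.2]
      exact congrArg _ (Subtype.ext heq)
  · change x.1 ∈ Ψ.source
    rw [hsrc]
    exact ⟨hxΦ, hxO⟩

end VortexQuiver

end

theorem mainTheorem3 (L : ℕ) (k n : ℕ → ℕ) :
    -- the differentials of all scalar constraints are linearly independent at every free point,
    -- and the Jacobian of the constraint map has maximal rank there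
    (∀ x : VortexQuiver.Data L k n, VortexQuiver.IsFree x →
      LinearIndependent ℂ
        (fun c : (i : Fin (L - 1)) × (Fin (k i) × Fin (k (i + 1))) =>
          fderiv ℂ (fun y : VortexQuiver.Data L k n =>
            VortexQuiver.constraintMap y c.1 c.2.1 c.2.2) x) ∧
      Module.finrank ℂ
        (LinearMap.range (fderiv ℂ (VortexQuiver.constraintMap (L := L) (k := k) (n := n)) x
          : VortexQuiver.Data L k n →ₗ[ℂ] ((i : Fin (L - 1)) → Fin (k i) → Fin (k (i + 1)) → ℂ)))
        = VortexQuiver.numConstraints L k) ∧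
    -- the solution set is a complex submanifold of the space of matrix data, and the quotient is
    -- a complex manifold of the expected dimension onto which it projects by a submersion
    T2Space (VortexQuiver.ModuliSpace L k n) ∧
    SecondCountableTopology (VortexQuiver.ModuliSpace L k n) ∧
    ∃ (_ : ChartedSpace
          (EuclideanSpace ℂ (Fin (VortexQuiver.moduliDim L k n + VortexQuiver.gaugeDim L k)))
          (VortexQuiver.solutionSet L k n))
      (_ : ChartedSpace (EuclideanSpace ℂ (Fin (VortexQuiver.moduliDim L k n)))
          (VortexQuiver.ModuliSpace L k n)),
      IsManifold
        𝓘(ℂ, EuclideanSpace ℂ (Fin (VortexQuiver.moduliDim L k n + VortexQuiver.gaugeDim L k)))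
        ω (VortexQuiver.solutionSet L k n) ∧
      Manifold.IsSmoothEmbedding
        𝓘(ℂ, EuclideanSpace ℂ (Fin (VortexQuiver.moduliDim L k n + VortexQuiver.gaugeDim L k)))
        𝓘(ℂ, VortexQuiver.Data L k n) ω
        (Subtype.val : VortexQuiver.solutionSet L k n → VortexQuiver.Data L k n) ∧
      IsManifold 𝓘(ℂ, EuclideanSpace ℂ (Fin (VortexQuiver.moduliDim L k n)))
        ω (VortexQuiver.ModuliSpace L k n) ∧
      Manifold.IsSubmersion
        𝓘(ℂ, EuclideanSpace ℂ (Fin (VortexQuiver.moduliDim L k n + VortexQuiver.gaugeDim L k)))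
        𝓘(ℂ, EuclideanSpace ℂ (Fin (VortexQuiver.moduliDim L k n))) ω
        (VortexQuiver.proj L k n) := by
  open VortexQuiver in
  refine ⟨fun x hx => ⟨linearIndependent_fderiv hx, ?_⟩, inferInstance, inferInstance, ?_⟩
  · rw [LinearMap.range_eq_top.2 (fderiv_constraintMap_surjective hx), finrank_top,
      finrank_constraints]
  · refine AdaptedChart.exists_manifold_structures isOpenQuotientMap_proj exists_adaptedChart
      (fun y y' => exists_transform)
      (ContinuousLinearEquiv.ofFinrankEq ?_) (ContinuousLinearEquiv.ofFinrankEq ?_)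
    · rw [Module.finrank_prod, finrank_gauge, finrank_euclideanSpace_fin,
        finrank_euclideanSpace_fin]
    · rw [finrank_data, Module.finrank_prod, Module.finrank_prod, finrank_gauge,
        finrank_constraints, finrank_euclideanSpace_fin, add_assoc]
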